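/- Let $n\ge 2$, let $\Omega\subset\mathbb R^n$ be a bounded domain, $\mathbb R_+=[0,\infty)$, and let $g:\Omega\times\mathbb R_+\to\mathbb R_+$ satisfy the following conditions. (g) $g(\cdot,v)\in L^1(\Omega)$ for all $v\ge 0$; for almost all $x\in\Omega$ the function $g(x,\cdot)$ is continuous and non-decreasing, with $\lim_{v\to+0}g(x,v)=0$ and $\lim_{v\to+\infty}g(x,v)=+\infty$. (g$_1$) There are $c_1>0$, $q>1$, $b_0\ge 0$ with $\dfrac{g(x,w)}{g(x,v)}\le c_1\left(\dfrac wv\right)^{q-1}$ for all $x\in\Omega$ and all $w\ge v\ge b_0$, $v>0$. (g$_2$) There is $p>1$ with $\dfrac{g(x,w)}{g(x,v)}\ge\left(\dfrac wv\right)^{p-1}$ for all $x\in\Omega$ and all $w\ge v>0$ (in particular $g(x,v)>0$ for $v>0$). (g$_3$) There are $r_*>0$, a continuous non-increasing function $\lambda:(0,r_*)\to\mathbb R_+$ and constants $c_2(K)>0$, $K>0$, such that for every $K>0$, every ball $B_{8r}(y)\subset\Omega$ with $0<r<r_*$, all $x_1,x_2\in B_r(y)$ and all $r\le v\le K$, $$g(x_1,v/r)\le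 c_2(K)\,e^{\lambda(r)}\,g(x_2,v/r).$$ Put $G(x,v)=g(x,v)v$. For open $U$, write $u\in W^{1,G}(U)$ if $u\in W^{1,1}(U)$ and $\int_U G(x,|\nabla u|)\,dx<\infty$; write $u\in W^{1,G}_{\rm loc}(\Omega)$ if $u\in W^{1,G}(E)$ for every open $E$ whose closure is a compact subset of $\Omega$; let $W^{1,G}_0(\Omega)$ be the set of $\varphi\in W^{1,G}(\Omega)$ with compact support in $\Omega$. A bounded weak solution of $\operatorname{div}\big(g(x,|\nabla u|)\frac{\nabla u}{|\nabla u|}\big)=0$ in $\Omega$ is a function $u\in W^{1,G}_{\rm loc}(\Omega)\cap L^\infty(\Omega)$ with $$\int_\Omega g(x,|\nabla u|)\frac{\nabla u}{|\nabla u|}\cdot\nabla\varphi\,dx=0\quad\text{for all }\varphi\in W^{1,G}_0(\Omega),$$ where the vector $g(x,|\nabla u|)\nabla u/|\nabla u|$ is read as $0$ where $\nabla u=0$. Theorem (Moser-type sub-estimate). Let $u\ge 0$ be a bounded weak solution and put $M=\operatorname{ess\,sup}_\Omega|u|$. There is a constant $\gamma>0$, depending only on $n,p,q,c_1,M$ and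 $c_2(M)$, such that the following holds for every $x_0\in\Omega$ and every $0<\rho<r_*$ with $B_{8\rho}(x_0)\subset\Omega$. With $M(\rho)=\operatorname{ess\,sup}_{B_\rho(x_0)}u$, $$g\Big(x_0,\frac{M(\rho)+2(1+b_0)\rho}{\rho}\Big)\le\gamma\,e^{2n\lambda(27\rho/28)}\,\frac{1}{|B_{5\rho/4}(x_0)|}\int_{B_{5\rho/4}(x_0)}g\Big(x_0,\frac{u+2(1+b_0)\rho}{\rho}\Big)dx .$$ If moreover $B_{33\rho/4}(x_0)\subset\Omega$, then $$g\Big(x_0,\frac{M(\rho)+2(1+b_0)\rho}{\rho}\Big)\le\gamma\,e^{2n\lambda(\rho)}\,\frac{1}{|B_{5\rho/4}(x_0)|}\int_{B_{5\rho/4}(x_0)}g\Big(x_0,\frac{u+2(1+b_0)\rho}{\rho}\Big)dx .$$ -/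

import Mathlib

open MeasureTheory Filter Topology Set
open scoped ContDiff

namespace OrliczHarnack

/-- `V` is the weak gradient of `u` on the open set `U`: both are locally integrable on `U` and
`∫ u ∂ₑψ = -∫ ⟨V, e⟩ ψ` for every `ψ ∈ C_c^∞(U)` and every direction `e`. -/
def IsWeakGradient {n : ℕ} (U : Set (EuclideanSpace ℝ (Fin n)))
    (u : EuclideanSpace ℝ (Fin n) → ℝ)
    (V : EuclideanSpace ℝ (Fin n) → EuclideanSpace ℝ (Fin n)) : Prop :=
  LocallyIntegrableOn u U volume ∧ LocallyIntegrableOn V U volume ∧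
    ∀ ψ : EuclideanSpace ℝ (Fin n) → ℝ,
      ContDiff ℝ ∞ ψ → HasCompactSupport ψ → tsupport ψ ⊆ U →
      ∀ e : EuclideanSpace ℝ (Fin n),
        ∫ x in U, u x * fderiv ℝ ψ x e = - ∫ x in U, inner ℝ (V x) e * ψ x

/-- `u ∈ W^{1,G}(U)`, `G(x, v) = g(x, v) v`, with weak gradient `V`: `u ∈ W^{1,1}(U)` and
`∫_U G(x, |∇u|) dx < ∞`. -/
def MemW1G {n : ℕ} (U : Set (EuclideanSpace ℝ (Fin n)))
    (g : EuclideanSpace ℝ (Fin n) → ℝ → ℝ)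
    (u : EuclideanSpace ℝ (Fin n) → ℝ)
    (V : EuclideanSpace ℝ (Fin n) → EuclideanSpace ℝ (Fin n)) : Prop :=
  IsWeakGradient U u V ∧ IntegrableOn u U volume ∧ IntegrableOn V U volume ∧
    IntegrableOn (fun x => g x ‖V x‖ * ‖V x‖) U volume

/-- `u ∈ W^{1,G}_loc(Ω)` with weak gradient `V`: `u ∈ W^{1,G}(E)` for every open `E` whose closure
is a compact subset of `Ω`. -/
def MemW1GLoc {n : ℕ} (Ω : Set (EuclideanSpace ℝ (Fin n)))
    (g : EuclideanSpace ℝ (Fin n) → ℝ → ℝ)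
    (u : EuclideanSpace ℝ (Fin n) → ℝ)
    (V : EuclideanSpace ℝ (Fin n) → EuclideanSpace ℝ (Fin n)) : Prop :=
  IsWeakGradient Ω u V ∧
    ∀ E : Set (EuclideanSpace ℝ (Fin n)),
      IsOpen E → IsCompact (closure E) → closure E ⊆ Ω → MemW1G E g u V

/-- `φ ∈ W^{1,G}_0(Ω)` with weak gradient `Φ`: `φ ∈ W^{1,G}(Ω)` has compact support in `Ω`, that is,
`φ` vanishes almost everywhere outside some compact subset of `Ω`. -/
def MemW1GZero {n : ℕ} (Ω : Set (EuclideanSpace ℝ (Fin n)))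
    (g : EuclideanSpace ℝ (Fin n) → ℝ → ℝ)
    (φ : EuclideanSpace ℝ (Fin n) → ℝ)
    (Φ : EuclideanSpace ℝ (Fin n) → EuclideanSpace ℝ (Fin n)) : Prop :=
  MemW1G Ω g φ Φ ∧
    ∃ K : Set (EuclideanSpace ℝ (Fin n)), IsCompact K ∧ K ⊆ Ω ∧
      ∀ᵐ x ∂(volume.restrict Ω), x ∉ K → φ x = 0

/-- `u` is a bounded weak solution of `div (g(x, |∇u|) ∇u / |∇u|) = 0` in `Ω`. Where `∇u = 0` the
vector `g(x, |∇u|) ∇u / |∇u|` is `0`, in Lean as in the equation. -/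
def IsBoundedWeakSolution {n : ℕ} (Ω : Set (EuclideanSpace ℝ (Fin n)))
    (g : EuclideanSpace ℝ (Fin n) → ℝ → ℝ)
    (u : EuclideanSpace ℝ (Fin n) → ℝ) : Prop :=
  MemLp u ⊤ (volume.restrict Ω) ∧
    ∃ V : EuclideanSpace ℝ (Fin n) → EuclideanSpace ℝ (Fin n),
      MemW1GLoc Ω g u V ∧
      ∀ (φ : EuclideanSpace ℝ (Fin n) → ℝ)
        (Φ : EuclideanSpace ℝ (Fin n) → EuclideanSpace ℝ (Fin n)),
        MemW1GZero Ω g φ Φ →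
        ∫ x in Ω, inner ℝ ((g x ‖V x‖ / ‖V x‖) • V x) (Φ x) = 0

/-- Condition `(g)`, for `g : Ω × [0, ∞) → [0, ∞)`. -/
def CondG {n : ℕ} (Ω : Set (EuclideanSpace ℝ (Fin n)))
    (g : EuclideanSpace ℝ (Fin n) → ℝ → ℝ) : Prop :=
  (∀ x ∈ Ω, ∀ v, 0 ≤ v → 0 ≤ g x v) ∧
  (∀ v, 0 ≤ v → IntegrableOn (fun x => g x v) Ω volume) ∧
  ∀ᵐ x ∂(volume.restrict Ω),
    ContinuousOn (g x) (Ici 0) ∧ MonotoneOn (g x) (Ici 0) ∧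
      Tendsto (g x) (𝓝[>] 0) (𝓝 0) ∧ Tendsto (g x) atTop atTop

/-- Condition `(g₁)` with constants `c₁ > 0`, `q > 1`, `b₀ ≥ 0`. -/
def CondG1 {n : ℕ} (Ω : Set (EuclideanSpace ℝ (Fin n)))
    (g : EuclideanSpace ℝ (Fin n) → ℝ → ℝ) (c₁ q b₀ : ℝ) : Prop :=
  0 < c₁ ∧ 1 < q ∧ 0 ≤ b₀ ∧
    ∀ x ∈ Ω, ∀ v w, 0 < v → b₀ ≤ v → v ≤ w → g x w / g x v ≤ c₁ * (w / v) ^ (q - 1)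

/-- Condition `(g₂)` with constant `p > 1`. Since `(w / v) ^ (p - 1) > 0`, it includes
`g x v > 0` for `v > 0`. -/
def CondG2 {n : ℕ} (Ω : Set (EuclideanSpace ℝ (Fin n)))
    (g : EuclideanSpace ℝ (Fin n) → ℝ → ℝ) (p : ℝ) : Prop :=
  1 < p ∧ ∀ x ∈ Ω, ∀ v w, 0 < v → v ≤ w → (w / v) ^ (p - 1) ≤ g x w / g x v

/-- Condition `(g₃)` with constants `c₂(K)` and a continuous non-increasing
`lam : (0, rStar) → [0, ∞)`. -/
def CondG3 {n : ℕ} (Ω : Set (EuclideanSpace ℝ (Fin n)))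
    (g : EuclideanSpace ℝ (Fin n) → ℝ → ℝ) (c₂ : ℝ → ℝ) (rStar : ℝ) (lam : ℝ → ℝ) : Prop :=
  0 < rStar ∧ ContinuousOn lam (Ioo 0 rStar) ∧ AntitoneOn lam (Ioo 0 rStar) ∧
  (∀ r ∈ Ioo 0 rStar, 0 ≤ lam r) ∧
  ∀ K, 0 < K → 0 < c₂ K ∧
    ∀ y r, r ∈ Ioo 0 rStar → Metric.ball y (8 * r) ⊆ Ω →
      ∀ x₁ ∈ Metric.ball y r, ∀ x₂ ∈ Metric.ball y r, ∀ v, r ≤ v → v ≤ K →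
        g x₁ (v / r) ≤ c₂ K * Real.exp (lam r) * g x₂ (v / r)

end OrliczHarnack

/-! The proof is De Giorgi's method with the nonlinearity frozen at one value, followed by a
doubling argument.

Energy. Let `m` bound u + k on a ball, put A₀ = g(x₀, m/ρ), and suppose that g(x, m/ρ) agrees with
A₀ up to a factor κ ≥ 1. Test the equation with T² ζ^s, where T = (u - a)₊ and s ≥ q. The term
containing ∇ζ is half absorbed by the energy, and by (g₁) the rest costs only g(x, m/ρ)(m/ρ)T
(`Growth.young`). Conversely the energy controls |∇u|, since g(x, |∇u|) ≥ A₀/κ where |∇u| ≥ m/ρ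
(`Growth.gradient_le`). A₀ cancels, and ∫ |∇(T² ζ^s)| ≤ C κ² (m/ρ) ∫ T remains, with no trace of g
(`integral_norm_levelGrad_le`). The W^{1,1} Sobolev inequality and Chebyshev's inequality then link
consecutive superlevel sets. Fast geometric convergence gives `exists_deGiorgi`: if {u + k > m/4}
has measure at most ε κ^(-2n) ((R - r)/ρ)^(sn) ρ^n in B_R, then u + k ≤ m/2 in B_r.

Doubling (`exists_subestimate`). Let radii R_i increase from ρ towards 5ρ/4, and let m_i be the
supremum of u + k over B_{R_i}. Either m_{i+1} ≥ 2 m_i, or {u + k > m_{i+1}/4} is large. In the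
second case (g₁) bounds g(x₀, m_{i+1}/ρ) by κ^(2n) times the average of g(x₀, (u + k)/ρ), up to a
factor that grows with i because the gaps between the radii shrink. The gaps are tuned so that this
factor is a constant times 2^(i(p-1)), which is the growth (g₂) guarantees when the argument is
multiplied by 2^i. If the estimate failed at m_0, the first alternative would therefore hold for
every i, and m_i ≥ 2^i m_0 would contradict the boundedness of u.

Comparison. Each x in B_{5ρ/4}(x₀) shares with x₀ a ball B_r(y) whose eightfold enlargement lies in
B_{7r+5ρ/4}(x₀). So (g₃) gives κ = D e^{λ(r)}, and κ^(2n) produces the factor e^{2nλ(r)}. The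
choices r = 27ρ/28 and r = ρ give the two assertions. -/

namespace OrliczHarnack

/-! ### Mollification of integrable functions and of weak gradients. -/

section Mollify

open ContinuousLinearMap Convolution

variable {n : ℕ} {F : Type*} [NormedAddCommGroup F] [NormedSpace ℝ F]

/-- The bump functions `φ_k`, supported in the ball of radius `2 / (k + 1)`, used to mollify. -/
noncomputable def mollifier (n k : ℕ) : ContDiffBump (0 : EuclideanSpace ℝ (Fin n)) where
  rIn := 1 / ((k : ℝ) + 1)
  rOut := 2 / ((k : ℝ) + 1)
  rIn_pos := by positivity
  rIn_lt_rOut := by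
    have : (0 : ℝ) < (k : ℝ) + 1 := by positivity
    gcongr
    norm_num

/-- Mollification of `f` at scale `2 / (k + 1)`. -/
noncomputable def mollify (k : ℕ) (f : EuclideanSpace ℝ (Fin n) → F) :
    EuclideanSpace ℝ (Fin n) → F :=
  (mollifier n k).normed volume ⋆[lsmul ℝ ℝ, volume] f

theorem mollify_apply (k : ℕ) (f : EuclideanSpace ℝ (Fin n) → F)
    (x : EuclideanSpace ℝ (Fin n)) :
    mollify k f x = ∫ t, (mollifier n k).normed volume (x - t) • f t := by
  rw [mollify, convolution_eq_swap]
  rfl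

theorem tendsto_rOut_mollifier (n : ℕ) :
    Tendsto (fun k => (mollifier n k).rOut) atTop (𝓝 0) := by
  have h := (tendsto_one_div_add_atTop_nhds_zero_nat (𝕜 := ℝ)).const_mul 2
  simp only [mul_zero] at h
  refine h.congr fun k => ?_
  simp [mollifier, div_eq_mul_inv]

theorem ae_tendsto_mollify [CompleteSpace F] {f : EuclideanSpace ℝ (Fin n) → F}
    (hf : LocallyIntegrable f volume) :
    ∀ᵐ x, Tendsto (fun k => mollify k f x) atTop (𝓝 (f x)) := by
  -- 2 is the fixed ratio of outer to inner radius; Lebesgue differentiation needs it bounded.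
  refine ContDiffBump.ae_convolution_tendsto_right_of_locallyIntegrable (K := 2)
    (tendsto_rOut_mollifier n) (Eventually.of_forall fun k => ?_) hf
  simp [mollifier, div_eq_mul_inv]

theorem integrable_mollifier (n k : ℕ) :
    Integrable ((mollifier n k).normed volume) volume :=
  (mollifier n k).integrable_normed

theorem integrable_mollify (k : ℕ) {f : EuclideanSpace ℝ (Fin n) → F}
    (hf : Integrable f volume) : Integrable (mollify k f) volume :=
  (integrable_mollifier n k).integrable_convolution _ hf

theorem mollify_integrand_integrable (k : ℕ) {f : EuclideanSpace ℝ (Fin n) → F}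
    (hf : Integrable f volume) (x : EuclideanSpace ℝ (Fin n)) :
    Integrable (fun t => (mollifier n k).normed volume (x - t) • f t) volume := by
  have h := (mollifier n k).hasCompactSupport_normed (μ := volume)
  have hc := (mollifier n k).continuous_normed (μ := volume)
  have := h.convolutionExists_left (lsmul ℝ ℝ) hc hf.locallyIntegrable x
  exact this.integrable_swap

theorem norm_mollify_le (k : ℕ) (f : EuclideanSpace ℝ (Fin n) → F)
    (x : EuclideanSpace ℝ (Fin n)) :
    ‖mollify k f x‖ ≤ mollify k (fun t => ‖f t‖) x := by
  rw [mollify_apply, mollify_apply]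
  refine (norm_integral_le_integral_norm _).trans (le_of_eq ?_)
  congr 1
  ext t
  rw [norm_smul, Real.norm_of_nonneg ((mollifier n k).nonneg_normed _), smul_eq_mul]

theorem integral_mollify (k : ℕ) {f : EuclideanSpace ℝ (Fin n) → ℝ}
    (hf : Integrable f volume) : ∫ x, mollify k f x = ∫ x, f x := by
  have h := integral_convolution (lsmul ℝ ℝ) (integrable_mollifier n k) hf
  rw [(mollifier n k).integral_normed] at h
  simpa [mollify] using h

theorem integral_mollifier_sub (k : ℕ) (x : EuclideanSpace ℝ (Fin n)) :
    ∫ t, (mollifier n k).normed volume (x - t) = 1 := by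
  rw [integral_sub_left_eq_self (fun t => (mollifier n k).normed volume t) volume x]
  exact (mollifier n k).integral_normed

theorem norm_mollify_le_of_bound (k : ℕ) {f : EuclideanSpace ℝ (Fin n) → F} {B : ℝ}
    (hB : ∀ᵐ x, ‖f x‖ ≤ B) (x : EuclideanSpace ℝ (Fin n)) :
    ‖mollify k f x‖ ≤ B := by
  have hi : Integrable (fun t => (mollifier n k).normed volume (x - t)) volume :=
    (integrable_mollifier n k).comp_sub_left x
  rw [mollify_apply]
  calc _ ≤ ∫ t, (mollifier n k).normed volume (x - t) * B := by
        refine norm_integral_le_of_norm_le (hi.mul_const B) ?_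
        filter_upwards [hB] with t ht
        rw [norm_smul, Real.norm_of_nonneg ((mollifier n k).nonneg_normed _)]
        exact mul_le_mul_of_nonneg_left ht ((mollifier n k).nonneg_normed _)
    _ = B := by rw [integral_mul_const, integral_mollifier_sub, one_mul]

theorem contDiff_mollify (k : ℕ) {f : EuclideanSpace ℝ (Fin n) → F}
    (hf : LocallyIntegrable f volume) : ContDiff ℝ ∞ (mollify k f) :=
  (mollifier n k).hasCompactSupport_normed.contDiff_convolution_left _
    (mollifier n k).contDiff_normed hf

theorem hasCompactSupport_mollify (k : ℕ) {f : EuclideanSpace ℝ (Fin n) → F}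
    (hf : HasCompactSupport f) : HasCompactSupport (mollify k f) :=
  HasCompactSupport.convolution _ (mollifier n k).hasCompactSupport_normed hf

/-- Dominated convergence with converging dominating functions of constant integral. -/
theorem tendsto_integral_zero_of_le_of_integral_eq {α : Type*} [MeasurableSpace α]
    {μ : Measure α} {d H : ℕ → α → ℝ} {H₀ : α → ℝ}
    (hd : ∀ k, Integrable (d k) μ) (hH : ∀ k, Integrable (H k) μ) (hH₀ : Integrable H₀ μ)
    (hd0 : ∀ k x, 0 ≤ d k x) (hdH : ∀ k x, d k x ≤ H k x) (hH0 : ∀ x, 0 ≤ H₀ x)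
    (hlim : ∀ᵐ x ∂μ, Tendsto (fun k => d k x) atTop (𝓝 0))
    (hlimH : ∀ᵐ x ∂μ, Tendsto (fun k => H k x) atTop (𝓝 (H₀ x)))
    (hint : ∀ k, ∫ x, H k x ∂μ = ∫ x, H₀ x ∂μ) :
    Tendsto (fun k => ∫ x, d k x ∂μ) atTop (𝓝 0) := by
  -- The proof rests on d ≤ min(d, H₀) + (H - H₀)₊. The minimum is dominated by H₀. Equality of the
  -- integrals lets (H - H₀)₊ be exchanged for (H₀ - H)₊, which is dominated by H₀ as well.
  have h1 : Tendsto (fun k => ∫ x, max (H₀ x - H k x) 0 ∂μ) atTop (𝓝 (∫ _, (0 : ℝ) ∂μ)) := by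
    refine tendsto_integral_of_dominated_convergence H₀
      (fun k => (hH₀.sub (hH k)).pos_part.aestronglyMeasurable) hH₀ (fun k => ?_) ?_
    · refine Eventually.of_forall fun x => ?_
      rw [Real.norm_of_nonneg (le_max_right _ _)]
      exact max_le (by linarith [(hd0 k x).trans (hdH k x)]) (hH0 x)
    · filter_upwards [hlimH] with x hx
      have := (tendsto_const_nhds (x := H₀ x)).sub hx |>.max (tendsto_const_nhds (x := (0 : ℝ)))
      simpa using this
  have h2 : Tendsto (fun k => ∫ x, min (d k x) (H₀ x) ∂μ) atTop (𝓝 (∫ _, (0 : ℝ) ∂μ)) := by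
    refine tendsto_integral_of_dominated_convergence H₀
      (fun k => ((hd k).inf hH₀).aestronglyMeasurable) hH₀ (fun k => ?_) ?_
    · refine Eventually.of_forall fun x => ?_
      rw [Real.norm_of_nonneg (le_min (hd0 k x) (hH0 x))]
      exact min_le_right _ _
    · filter_upwards [hlim] with x hx
      have := hx.min (tendsto_const_nhds (x := H₀ x))
      rwa [min_eq_left (hH0 x)] at this
  simp only [integral_zero] at h1 h2
  have i1 : ∀ k, Integrable (fun x => max (H k x - H₀ x) 0) μ :=
    fun k => ((hH k).sub hH₀).pos_part
  have i2 : ∀ k, Integrable (fun x => H₀ x - H k x) μ := fun k => hH₀.sub (hH k)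
  have i3 : ∀ k, Integrable (fun x => min (d k x) (H₀ x)) μ := fun k => (hd k).inf hH₀
  have h3 := h2.add h1
  rw [add_zero] at h3
  refine squeeze_zero (fun k => integral_nonneg (hd0 k)) (fun k => ?_) h3
  have e1 : ∫ x, max (H₀ x - H k x) 0 ∂μ = ∫ x, max (H k x - H₀ x) 0 ∂μ := by
    have : ∀ x, max (H₀ x - H k x) 0 = max (H k x - H₀ x) 0 + (H₀ x - H k x) := by
      intro x
      rcases le_total (H₀ x) (H k x) with h | h
      · rw [max_eq_right (by linarith), max_eq_left (by linarith)]; ring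
      · rw [max_eq_left (by linarith), max_eq_right (by linarith)]; ring
    simp_rw [this]
    rw [integral_add (i1 k) (i2 k), integral_sub hH₀ (hH k), hint k]
    ring
  rw [e1, ← integral_add (i3 k) (i1 k)]
  refine integral_mono (hd k) ((i3 k).add (i1 k)) fun x => ?_
  show d k x ≤ min (d k x) (H₀ x) + max (H k x - H₀ x) 0
  rcases le_total (d k x) (H₀ x) with h | h
  · rw [min_eq_left h]; linarith [le_max_right (H k x - H₀ x) 0]
  · rw [min_eq_right h]; linarith [le_max_left (H k x - H₀ x) 0, hdH k x]

/-- Mollifications of an integrable function converge in `L¹`. -/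
theorem tendsto_integral_norm_mollify_sub [CompleteSpace F]
    {f : EuclideanSpace ℝ (Fin n) → F} (hf : Integrable f volume) :
    Tendsto (fun k => ∫ x, ‖mollify k f x - f x‖) atTop (𝓝 0) := by
  -- Mollification preserves the integral of ‖f‖, so every dominating function has integral 2 ∫ ‖f‖.
  refine tendsto_integral_zero_of_le_of_integral_eq
    (H := fun k x => mollify k (fun t => ‖f t‖) x + ‖f x‖) (H₀ := fun x => ‖f x‖ + ‖f x‖)
    (fun k => ((integrable_mollify k hf).sub hf).norm)
    (fun k => (integrable_mollify k hf.norm).add hf.norm) (hf.norm.add hf.norm)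
    (fun k x => norm_nonneg _) (fun k x => ?_) (fun x => by positivity) ?_ ?_ (fun k => ?_)
  · exact (norm_sub_le _ _).trans (add_le_add_left (norm_mollify_le k f x) _)
  · filter_upwards [ae_tendsto_mollify hf.locallyIntegrable] with x hx
    simpa using (hx.sub_const (f x)).norm
  · filter_upwards [ae_tendsto_mollify hf.norm.locallyIntegrable] with x hx
    exact hx.add_const _
  · rw [integral_add (integrable_mollify k hf.norm) hf.norm, integral_mollify k hf.norm,
      integral_add hf.norm hf.norm]

/-- Mollification commutes with the weak gradient. -/
theorem fderiv_mollify {v : EuclideanSpace ℝ (Fin n) → ℝ}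
    {W : EuclideanSpace ℝ (Fin n) → EuclideanSpace ℝ (Fin n)}
    (hv : Integrable v volume) (hW : Integrable W volume) (h : IsWeakGradient univ v W)
    (k : ℕ) (x e : EuclideanSpace ℝ (Fin n)) :
    fderiv ℝ (mollify k v) x e = inner ℝ (mollify k W x) e := by
  set φ := (mollifier n k).normed (volume : Measure (EuclideanSpace ℝ (Fin n))) with hφ
  have hφc : HasCompactSupport φ := (mollifier n k).hasCompactSupport_normed
  have hφs : ContDiff ℝ ∞ φ := (mollifier n k).contDiff_normed
  have hd : ∀ t, fderiv ℝ (fun t => φ (x - t)) t e = -(fderiv ℝ φ (x - t) e) := by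
    intro t
    have h1 : HasFDerivAt φ (fderiv ℝ φ (x - t)) (x - t) :=
      (hφs.differentiable (by simp) _).hasFDerivAt
    have h2 := h1.comp t ((hasFDerivAt_id t).const_sub x)
    have h3 : HasFDerivAt (fun t => φ (x - t)) _ t := h2
    rw [h3.fderiv]
    simp
  obtain ⟨L, hL, hD⟩ : ∃ L : (EuclideanSpace ℝ (Fin n) →L[ℝ] ℝ) →L[ℝ] ℝ →L[ℝ]
      (EuclideanSpace ℝ (Fin n) →L[ℝ] ℝ), (∀ A c, L A c e = A e * c) ∧
      HasFDerivAt (φ ⋆[lsmul ℝ ℝ, volume] v) ((fderiv ℝ φ ⋆[L, volume] v) x) x :=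
    ⟨(lsmul ℝ ℝ).precompL (EuclideanSpace ℝ (Fin n)), fun A c => rfl,
      hφc.hasFDerivAt_convolution_left (lsmul ℝ ℝ) (hφs.of_le (by simp)) hv.locallyIntegrable x⟩
  rw [show mollify k v = φ ⋆[lsmul ℝ ℝ, volume] v from rfl, hD.fderiv, convolution_eq_swap]
  have hi : Integrable (fun t => L (fderiv ℝ φ (x - t)) (v t)) volume :=
    ((hφc.fderiv (𝕜 := ℝ)).convolutionExists_left L
      (hφs.continuous_fderiv (by simp)) hv.locallyIntegrable x).integrable_swap
  rw [ContinuousLinearMap.integral_apply hi]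
  -- The reflected kernel is itself a test function; the sign from the reflection cancels the one in
  -- the definition of the weak gradient.
  have hw := h.2.2 (fun t => φ (x - t)) (hφs.comp (contDiff_const.sub contDiff_id))
    (hφc.comp_homeomorph (Homeomorph.subLeft x)) (subset_univ _) e
  simp only [Measure.restrict_univ, hd] at hw
  rw [mollify_apply, real_inner_comm, ← integral_inner (mollify_integrand_integrable k hW x)]
  simp_rw [hL]
  have e2 : ∀ t, v t * -(fderiv ℝ φ (x - t) e) = -(fderiv ℝ φ (x - t) e * v t) := by
    intro t; ring
  simp_rw [e2] at hw
  rw [integral_neg, neg_inj] at hw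
  rw [hw]
  congr 1
  ext t
  rw [inner_smul_right, real_inner_comm, mul_comm]

end Mollify

/-! ### Localization, product rule and chain rule for weak gradients. -/

theorem tendsto_integral_mul_of_bounded {α : Type*} [MeasurableSpace α] {μ : Measure α}
    {c : ℕ → α → ℝ} {c₀ f : α → ℝ} {C : ℝ}
    (hc : ∀ k, AEStronglyMeasurable (c k) μ) (hC : ∀ k x, |c k x| ≤ C) (hf : Integrable f μ)
    (hlim : ∀ᵐ x ∂μ, Tendsto (fun k => c k x) atTop (𝓝 (c₀ x))) :
    Tendsto (fun k => ∫ x, c k x * f x ∂μ) atTop (𝓝 (∫ x, c₀ x * f x ∂μ)) := by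
  refine tendsto_integral_of_dominated_convergence (fun x => C * ‖f x‖)
    (fun k => (hc k).mul hf.aestronglyMeasurable) (hf.norm.const_mul C) (fun k => ?_) ?_
  · refine Eventually.of_forall fun x => ?_
    rw [norm_mul]
    exact mul_le_mul_of_nonneg_right (hC k x) (norm_nonneg _)
  · filter_upwards [hlim] with x hx
    exact hx.mul_const _

theorem inner_gradient_eq_fderiv {n : ℕ} (f : EuclideanSpace ℝ (Fin n) → ℝ)
    (x e : EuclideanSpace ℝ (Fin n)) : inner ℝ (gradient f x) e = fderiv ℝ f x e := by
  simp [gradient]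

theorem norm_gradient_eq {n : ℕ} (f : EuclideanSpace ℝ (Fin n) → ℝ)
    (x : EuclideanSpace ℝ (Fin n)) : ‖gradient f x‖ = ‖fderiv ℝ f x‖ := by
  simp [gradient]

theorem continuous_gradient {n : ℕ} {f : EuclideanSpace ℝ (Fin n) → ℝ} (hf : ContDiff ℝ ∞ f) :
    Continuous (gradient f) :=
  (InnerProductSpace.toDual ℝ _).symm.continuous.comp (hf.continuous_fderiv (by simp))

theorem support_gradient_subset {n : ℕ} (f : EuclideanSpace ℝ (Fin n) → ℝ) :
    Function.support (gradient f) ⊆ tsupport f := by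
  intro x hx
  by_contra h
  apply hx
  have : fderiv ℝ f x = 0 := by
    by_contra h'
    exact h (support_fderiv_subset ℝ h')
  simp [gradient, this]

/-- Chain and product rule for the weak gradient on the whole space, tested form. -/
theorem integral_comp_mul_fderiv {n : ℕ} {v : EuclideanSpace ℝ (Fin n) → ℝ}
    {W : EuclideanSpace ℝ (Fin n) → EuclideanSpace ℝ (Fin n)}
    (hv : Integrable v volume) (hW : Integrable W volume) (h : IsWeakGradient univ v W)
    {B : ℝ} (hB : ∀ᵐ x, ‖v x‖ ≤ B) {F F' : ℝ → ℝ} (hF : ∀ t, HasDerivAt F (F' t) t)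
    (hF' : Continuous F') {θ : EuclideanSpace ℝ (Fin n) → ℝ} (hθ : ContDiff ℝ ∞ θ)
    (hθc : HasCompactSupport θ) {ψ : EuclideanSpace ℝ (Fin n) → ℝ} (hψ : ContDiff ℝ ∞ ψ)
    (e : EuclideanSpace ℝ (Fin n)) :
    ∫ x, F (v x) * θ x * fderiv ℝ ψ x e =
      -∫ x, inner ℝ ((F' (v x) * θ x) • W x + F (v x) • gradient θ x) e * ψ x := by
  have hFc : Continuous F := continuous_iff_continuousAt.2 fun t => (hF t).continuousAt
  obtain ⟨C, hC⟩ := (isCompact_Icc (a := -B) (b := B)).exists_bound_of_continuousOn hFc.continuousOn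
  obtain ⟨C', hC'⟩ :=
    (isCompact_Icc (a := -B) (b := B)).exists_bound_of_continuousOn hF'.continuousOn
  -- Mollification keeps the values in [-B, B], so `F` and `F'` enter only through their bounds on a
  -- compact interval.
  have hmem : ∀ k x, mollify k v x ∈ Icc (-B) B := fun k x =>
    abs_le.1 (norm_mollify_le_of_bound k hB x)
  have hvs : ∀ k, ContDiff ℝ ∞ (mollify k v) := fun k => contDiff_mollify k hv.locallyIntegrable
  have hψe : Continuous fun x => fderiv ℝ ψ x e :=
    (hψ.continuous_fderiv (by simp)).clm_apply continuous_const
  have hθe : Continuous fun x => fderiv ℝ θ x e :=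
    (hθ.continuous_fderiv (by simp)).clm_apply continuous_const
  have hθec : HasCompactSupport fun x => fderiv ℝ θ x e := hθc.fderiv_apply (𝕜 := ℝ) e
  have hd : ∀ k x, HasFDerivAt (fun x => F (mollify k v x) * θ x)
      (F (mollify k v x) • fderiv ℝ θ x + θ x • (F' (mollify k v x) • fderiv ℝ (mollify k v) x))
      x := fun k x =>
    ((hF _).comp_hasFDerivAt x ((hvs k).differentiable (by simp) x).hasFDerivAt).mul
      (hθ.differentiable (by simp) x).hasFDerivAt
  have hde : ∀ k x, fderiv ℝ (fun x => F (mollify k v x) * θ x) x e =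
      F (mollify k v x) * fderiv ℝ θ x e + F' (mollify k v x) * θ x * inner ℝ (mollify k W x) e := by
    intro k x
    rw [(hd k x).fderiv]
    simp [fderiv_mollify hv hW h k x e]
    ring
  have hFk : ∀ k, Continuous fun x => F (mollify k v x) := fun k => hFc.comp (hvs k).continuous
  have hFk' : ∀ k, Continuous fun x => F' (mollify k v x) := fun k => hF'.comp (hvs k).continuous
  -- the identity for the mollified functions
  have key : ∀ k, ∫ x, F (mollify k v x) * (θ x * fderiv ℝ ψ x e) =
      -((∫ x, F (mollify k v x) * (fderiv ℝ θ x e * ψ x)) +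
        ((∫ x, F' (mollify k v x) * (θ x * ψ x * inner ℝ (W x) e)) +
          ∫ x, F' (mollify k v x) * θ x * ψ x * inner ℝ (mollify k W x - W x) e)) := by
    intro k
    have i1 : Integrable (fun x => F (mollify k v x) * (fderiv ℝ θ x e * ψ x)) volume :=
      ((hFk k).mul (hθe.mul hψ.continuous)).integrable_of_hasCompactSupport
        (hθec.mul_right.mul_left)
    have cb : Continuous fun x => F' (mollify k v x) * θ x * ψ x :=
      ((hFk' k).mul hθ.continuous).mul hψ.continuous
    have cc : HasCompactSupport fun x => F' (mollify k v x) * θ x * ψ x :=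
      (hθc.mul_left (f := fun x => F' (mollify k v x))).mul_right
    obtain ⟨D, hD⟩ := cb.bounded_above_of_compact_support cc
    have i0 : ∀ {Z : EuclideanSpace ℝ (Fin n) → EuclideanSpace ℝ (Fin n)},
        Integrable Z volume →
        Integrable (fun x => F' (mollify k v x) * θ x * ψ x * inner ℝ (Z x) e) volume :=
      fun hZ => (hZ.inner_const e).bdd_mul cb.aestronglyMeasurable (Eventually.of_forall hD)
    have i2 : Integrable (fun x => F' (mollify k v x) * (θ x * ψ x * inner ℝ (W x) e)) volume := by
      refine (i0 hW).congr (Eventually.of_forall fun x => ?_)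
      ring
    have i3 : Integrable (fun x => F' (mollify k v x) * θ x * ψ x *
        inner ℝ (mollify k W x - W x) e) volume := i0 ((integrable_mollify k hW).sub hW)
    have i23 : Integrable (fun x => F' (mollify k v x) * (θ x * ψ x * inner ℝ (W x) e) +
        F' (mollify k v x) * θ x * ψ x * inner ℝ (mollify k W x - W x) e) volume := i2.add i3
    have hibp := integral_mul_fderiv_eq_neg_fderiv_mul_of_integrable (𝕜 := ℝ) (μ := volume)
      (f := fun x => F (mollify k v x) * θ x) (g := ψ) (v := e) ?_ ?_ ?_
      (fun x _ => (hd k x).differentiableAt) (fun x _ => hψ.differentiable (by simp) x)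
    · calc _ = ∫ x, F (mollify k v x) * θ x * fderiv ℝ ψ x e := by
            congr 1; ext x; ring
        _ = _ := by
            rw [hibp, neg_inj, ← integral_add i2 i3, ← integral_add i1 i23]
            congr 1
            ext x
            rw [hde, inner_sub_left]
            ring
    · simp_rw [hde]
      refine (i1.add (i0 (integrable_mollify k hW))).congr (Eventually.of_forall fun x => ?_)
      simp only [Pi.add_apply]
      ring
    · exact (((hFk k).mul hθ.continuous).mul hψe).integrable_of_hasCompactSupport
        (hθc.mul_left.mul_right)
    · exact (((hFk k).mul hθ.continuous).mul hψ.continuous).integrable_of_hasCompactSupport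
        (hθc.mul_left.mul_right)
  have hae := ae_tendsto_mollify hv.locallyIntegrable
  have limF : ∀ {f : EuclideanSpace ℝ (Fin n) → ℝ}, Integrable f volume →
      Tendsto (fun k => ∫ x, F (mollify k v x) * f x) atTop (𝓝 (∫ x, F (v x) * f x)) := by
    intro f hf
    refine tendsto_integral_mul_of_bounded (fun k => (hFk k).aestronglyMeasurable)
      (fun k x => hC _ (hmem k x)) hf ?_
    filter_upwards [hae] with x hx
    exact (hFc.tendsto _).comp hx
  have limF' : ∀ {f : EuclideanSpace ℝ (Fin n) → ℝ}, Integrable f volume →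
      Tendsto (fun k => ∫ x, F' (mollify k v x) * f x) atTop (𝓝 (∫ x, F' (v x) * f x)) := by
    intro f hf
    refine tendsto_integral_mul_of_bounded (fun k => (hFk' k).aestronglyMeasurable)
      (fun k x => hC' _ (hmem k x)) hf ?_
    filter_upwards [hae] with x hx
    exact (hF'.tendsto _).comp hx
  have cθψ : Continuous fun x => θ x * ψ x := hθ.continuous.mul hψ.continuous
  obtain ⟨D, hD⟩ := cθψ.bounded_above_of_compact_support hθc.mul_right
  have j0 : Integrable (fun x => θ x * fderiv ℝ ψ x e) volume :=
    (hθ.continuous.mul hψe).integrable_of_hasCompactSupport hθc.mul_right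
  have j1 : Integrable (fun x => fderiv ℝ θ x e * ψ x) volume :=
    (hθe.mul hψ.continuous).integrable_of_hasCompactSupport hθec.mul_right
  have j2 : Integrable (fun x => θ x * ψ x * inner ℝ (W x) e) volume :=
    (hW.inner_const e).bdd_mul cθψ.aestronglyMeasurable (Eventually.of_forall hD)
  -- The coefficients converge only almost everywhere, so the mollified gradient is split into `W`
  -- and an error. Against `W` dominated convergence applies; the error vanishes in L¹ against
  -- bounded coefficients.
  have lim3 : Tendsto (fun k => ∫ x, F' (mollify k v x) * θ x * ψ x *
      inner ℝ (mollify k W x - W x) e) atTop (𝓝 0) := by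
    have hb : Tendsto (fun k => C' * D * ‖e‖ * ∫ x, ‖mollify k W x - W x‖) atTop (𝓝 0) := by
      simpa using (tendsto_integral_norm_mollify_sub hW).const_mul (C' * D * ‖e‖)
    refine squeeze_zero_norm (fun k => ?_) hb
    rw [← integral_const_mul]
    refine norm_integral_le_of_norm_le
      ((((integrable_mollify k hW).sub hW).norm).const_mul _) (Eventually.of_forall fun x => ?_)
    rw [mul_assoc (F' _), norm_mul, norm_mul]
    calc _ ≤ C' * D * (‖mollify k W x - W x‖ * ‖e‖) := by
          have := hC' _ (hmem k x)
          have := hD x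
          have h0 : 0 ≤ C' := (norm_nonneg _).trans (hC' _ (hmem k x))
          have := norm_inner_le_norm (𝕜 := ℝ) (mollify k W x - W x) e
          have hD0 : 0 ≤ D := (norm_nonneg _).trans (hD x)
          gcongr
      _ = _ := by ring
  have lim1 := limF j0
  have lim2 := ((limF j1).add ((limF' j2).add lim3)).neg
  simp_rw [← key] at lim2
  have heq := tendsto_nhds_unique lim1 lim2
  -- integrability of the limits
  have mF : AEStronglyMeasurable (fun x => F (v x)) volume :=
    hFc.comp_aestronglyMeasurable hv.aestronglyMeasurable
  have mF' : AEStronglyMeasurable (fun x => F' (v x)) volume :=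
    hF'.comp_aestronglyMeasurable hv.aestronglyMeasurable
  have k1 : Integrable (fun x => F (v x) * (fderiv ℝ θ x e * ψ x)) volume := by
    refine j1.bdd_mul (c := C) mF ?_
    filter_upwards [hB] with x hx using hC _ (abs_le.1 hx)
  have k2 : Integrable (fun x => F' (v x) * (θ x * ψ x * inner ℝ (W x) e)) volume := by
    refine j2.bdd_mul (c := C') mF' ?_
    filter_upwards [hB] with x hx using hC' _ (abs_le.1 hx)
  calc _ = ∫ x, F (v x) * (θ x * fderiv ℝ ψ x e) := by
        congr 1; ext x; ring
    _ = _ := by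
        rw [heq, neg_inj, add_zero, ← integral_add k1 k2]
        congr 1
        ext x
        rw [inner_add_left, inner_smul_left, inner_smul_left, inner_gradient_eq_fderiv]
        simp
        ring

theorem integrable_smul_of_tsupport_subset {n : ℕ} {G : Type*} [NormedAddCommGroup G]
    [NormedSpace ℝ G] {Ω : Set (EuclideanSpace ℝ (Fin n))} {f : EuclideanSpace ℝ (Fin n) → G}
    (hf : LocallyIntegrableOn f Ω volume) {θ : EuclideanSpace ℝ (Fin n) → ℝ} (hθ : Continuous θ)
    (hθc : HasCompactSupport θ) (hθΩ : tsupport θ ⊆ Ω) :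
    Integrable (fun x => θ x • f x) volume := by
  have h1 : IntegrableOn f (tsupport θ) volume :=
    hf.integrableOn_compact_subset hθΩ hθc.isCompact
  obtain ⟨C, hC⟩ := hθ.bounded_above_of_compact_support hθc
  have h2 : IntegrableOn (fun x => θ x • f x) (tsupport θ) volume :=
    h1.bdd_smul C hθ.aestronglyMeasurable (Eventually.of_forall hC)
  refine (integrableOn_iff_integrable_of_support_subset ?_).1 h2
  intro x hx
  refine subset_tsupport θ fun h => hx ?_
  simp [h]

theorem integrable_smul_gradient {n : ℕ}
    {Ω : Set (EuclideanSpace ℝ (Fin n))} {f : EuclideanSpace ℝ (Fin n) → ℝ}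
    (hf : LocallyIntegrableOn f Ω volume) {θ : EuclideanSpace ℝ (Fin n) → ℝ}
    (hθ : ContDiff ℝ ∞ θ) (hθc : HasCompactSupport θ) (hθΩ : tsupport θ ⊆ Ω) :
    Integrable (fun x => f x • gradient θ x) volume := by
  have h1 : IntegrableOn f (tsupport θ) volume :=
    hf.integrableOn_compact_subset hθΩ hθc.isCompact
  have hgc : HasCompactSupport (gradient θ) :=
    hθc.mono' (support_gradient_subset θ)
  obtain ⟨C, hC⟩ := (continuous_gradient hθ).bounded_above_of_compact_support hgc
  have h2 : IntegrableOn (fun x => f x • gradient θ x) (tsupport θ) volume :=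
    h1.smul_bdd C (continuous_gradient hθ).aestronglyMeasurable (Eventually.of_forall hC)
  refine (integrableOn_iff_integrable_of_support_subset ?_).1 h2
  intro x hx
  refine support_gradient_subset θ fun h => hx ?_
  simp [h]

theorem setIntegral_eq_integral_of_tsupport_subset {n : ℕ} {Ω : Set (EuclideanSpace ℝ (Fin n))}
    {f : EuclideanSpace ℝ (Fin n) → ℝ} {θ : EuclideanSpace ℝ (Fin n) → ℝ}
    (hθΩ : tsupport θ ⊆ Ω) (hf : ∀ x, x ∉ tsupport θ → f x = 0) :
    ∫ x in Ω, f x = ∫ x, f x :=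
  setIntegral_eq_integral_of_forall_compl_eq_zero fun x hx => hf x fun h => hx (hθΩ h)

/-- Multiplying by a cutoff function extends a weak gradient on `Ω` to the whole space. -/
theorem IsWeakGradient.cutoff {n : ℕ} {Ω : Set (EuclideanSpace ℝ (Fin n))}
    {u : EuclideanSpace ℝ (Fin n) → ℝ} {V : EuclideanSpace ℝ (Fin n) → EuclideanSpace ℝ (Fin n)}
    (h : IsWeakGradient Ω u V) {η : EuclideanSpace ℝ (Fin n) → ℝ} (hη : ContDiff ℝ ∞ η)
    (hηc : HasCompactSupport η) (hηΩ : tsupport η ⊆ Ω) :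
    Integrable (fun x => η x * u x) volume ∧
    Integrable (fun x => η x • V x + u x • gradient η x) volume ∧
    IsWeakGradient univ (fun x => η x * u x) (fun x => η x • V x + u x • gradient η x) := by
  have i1 := integrable_smul_of_tsupport_subset h.1 hη.continuous hηc hηΩ
  have i2 := integrable_smul_of_tsupport_subset h.2.1 hη.continuous hηc hηΩ
  have i3 := integrable_smul_gradient h.1 hη hηc hηΩ
  refine ⟨i1, i2.add i3, i1.locallyIntegrable.locallyIntegrableOn _,
    (i2.add i3).locallyIntegrable.locallyIntegrableOn _, fun ψ hψ hψc _ e => ?_⟩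
  simp only [Measure.restrict_univ]
  have hsub : tsupport (fun x => η x * ψ x) ⊆ tsupport η := tsupport_mul_subset_left
  have hw := h.2.2 (fun x => η x * ψ x) (hη.mul hψ) hηc.mul_right (hsub.trans hηΩ) e
  have hfd : ∀ x, fderiv ℝ (fun x => η x * ψ x) x e =
      η x * fderiv ℝ ψ x e + ψ x * fderiv ℝ η x e := by
    intro x
    have h1 := (hη.differentiable (by simp) x).hasFDerivAt.mul
      (hψ.differentiable (by simp) x).hasFDerivAt
    have h2 : HasFDerivAt (fun x => η x * ψ x) _ x := h1
    rw [h2.fderiv]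
    simp
  have z1 : ∀ x, x ∉ tsupport η → η x = 0 := fun x hx => image_eq_zero_of_notMem_tsupport hx
  have z2 : ∀ x, x ∉ tsupport η → gradient η x = 0 := fun x hx => by
    by_contra h'
    exact hx (support_gradient_subset η h')
  simp_rw [hfd, ← inner_gradient_eq_fderiv η] at hw
  rw [setIntegral_eq_integral_of_tsupport_subset hηΩ (fun x hx => by simp [z1 x hx, z2 x hx]),
    setIntegral_eq_integral_of_tsupport_subset hηΩ (fun x hx => by simp [z1 x hx])] at hw
  obtain ⟨D, hD⟩ := hψ.continuous.bounded_above_of_compact_support hψc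
  have hψe : Continuous fun x => fderiv ℝ ψ x e :=
    (hψ.continuous_fderiv (by simp)).clm_apply continuous_const
  obtain ⟨D', hD'⟩ := hψe.bounded_above_of_compact_support (hψc.fderiv_apply (𝕜 := ℝ) e)
  have j1 : Integrable (fun x => fderiv ℝ ψ x e * (η x • u x)) volume :=
    i1.bdd_mul hψe.aestronglyMeasurable (Eventually.of_forall hD')
  have j2 : Integrable (fun x => ψ x * inner ℝ (η x • V x) e) volume :=
    (i2.inner_const e).bdd_mul hψ.continuous.aestronglyMeasurable (Eventually.of_forall hD)
  have j3 : Integrable (fun x => ψ x * inner ℝ (u x • gradient η x) e) volume :=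
    (i3.inner_const e).bdd_mul hψ.continuous.aestronglyMeasurable (Eventually.of_forall hD)
  have e1 : ∫ x, u x * (η x * fderiv ℝ ψ x e + ψ x * inner ℝ (gradient η x) e) =
      (∫ x, fderiv ℝ ψ x e * (η x • u x)) + ∫ x, ψ x * inner ℝ (u x • gradient η x) e := by
    rw [← integral_add j1 j3]
    congr 1
    ext x
    simp [inner_smul_left]
    ring
  have e2 : ∫ x, inner ℝ (η x • V x + u x • gradient η x) e * ψ x =
      (∫ x, ψ x * inner ℝ (η x • V x) e) + ∫ x, ψ x * inner ℝ (u x • gradient η x) e := by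
    rw [← integral_add j2 j3]
    congr 1
    ext x
    rw [inner_add_left]
    ring
  have e3 : ∫ x, inner ℝ (V x) e * (η x * ψ x) = ∫ x, ψ x * inner ℝ (η x • V x) e := by
    congr 1
    ext x
    simp [inner_smul_left]
    ring
  have e4 : ∫ x, η x * u x * fderiv ℝ ψ x e = ∫ x, fderiv ℝ ψ x e * (η x • u x) := by
    congr 1
    ext x
    simp
    ring
  rw [e4, e2]
  rw [e1, e3] at hw
  linarith

/-- The weak gradient of `F(u) θ` for `u` bounded, `F` continuously differentiable and `θ` a
test function. -/
theorem IsWeakGradient.comp_mul {n : ℕ} {Ω : Set (EuclideanSpace ℝ (Fin n))}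
    (hΩ : MeasurableSet Ω)
    {u : EuclideanSpace ℝ (Fin n) → ℝ} {V : EuclideanSpace ℝ (Fin n) → EuclideanSpace ℝ (Fin n)}
    (h : IsWeakGradient Ω u V) {B : ℝ} (hB : ∀ᵐ x ∂(volume.restrict Ω), |u x| ≤ B)
    {F F' : ℝ → ℝ} (hF : ∀ t, HasDerivAt F (F' t) t) (hF' : Continuous F')
    {η θ : EuclideanSpace ℝ (Fin n) → ℝ} (hη : ContDiff ℝ ∞ η)
    (hηc : HasCompactSupport η) (hηΩ : tsupport η ⊆ Ω)
    (hθ : ContDiff ℝ ∞ θ) (hθc : HasCompactSupport θ)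
    (hηθ : ∀ x ∈ tsupport θ, η x = 1) :
    Integrable (fun x => F (u x) * θ x) volume ∧
    Integrable (fun x => (F' (u x) * θ x) • V x + F (u x) • gradient θ x) volume ∧
    IsWeakGradient univ (fun x => F (u x) * θ x)
      (fun x => (F' (u x) * θ x) • V x + F (u x) • gradient θ x) := by
  obtain ⟨i1, i2, hw⟩ := h.cutoff hη hηc hηΩ
  have hFc : Continuous F := continuous_iff_continuousAt.2 fun t => (hF t).continuousAt
  set v : EuclideanSpace ℝ (Fin n) → ℝ := fun x => η x * u x with hv
  set W : EuclideanSpace ℝ (Fin n) → EuclideanSpace ℝ (Fin n) :=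
    fun x => η x • V x + u x • gradient η x with hWdef
  obtain ⟨Cη, hCη⟩ := hη.continuous.bounded_above_of_compact_support hηc
  have hvB : ∀ᵐ x, ‖v x‖ ≤ Cη * |B| := by
    filter_upwards [(ae_restrict_iff' hΩ).1 hB] with x hx
    rw [hv]
    by_cases hxη : x ∈ tsupport η
    · rw [norm_mul]
      exact mul_le_mul (hCη x) ((hx (hηΩ hxη)).trans (le_abs_self B)) (norm_nonneg _)
        ((norm_nonneg _).trans (hCη x))
    · simp only [image_eq_zero_of_notMem_tsupport hxη, zero_mul, norm_zero]
      exact mul_nonneg ((norm_nonneg _).trans (hCη x)) (abs_nonneg _)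
  have p1 : ∀ x, F (v x) * θ x = F (u x) * θ x := by
    intro x
    by_cases hx : x ∈ tsupport θ
    · rw [hv]; simp [hηθ x hx]
    · simp [image_eq_zero_of_notMem_tsupport hx]
  -- The set θ ≠ 0 is open and η = 1 on it, so ∇η vanishes there. Where θ = 0 the coefficient of `W`
  -- vanishes.
  have p2 : ∀ x, (F' (v x) * θ x) • W x + F (v x) • gradient θ x =
      (F' (u x) * θ x) • V x + F (u x) • gradient θ x := by
    intro x
    by_cases hx : x ∈ tsupport θ
    · have hvx : v x = u x := by rw [hv]; simp [hηθ x hx]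
      rw [hvx]
      by_cases hθx : θ x = 0
      · simp [hθx]
      · have hopen : IsOpen (Function.support θ) := hθ.continuous.isOpen_support
        have hev : η =ᶠ[𝓝 x] fun _ => (1 : ℝ) := by
          filter_upwards [hopen.mem_nhds hθx] with y hy
          exact hηθ y (subset_tsupport θ hy)
        have hg : gradient η x = 0 := by
          simp [gradient, hev.fderiv_eq]
        rw [hWdef]
        simp [hg, hηθ x hx]
    · have hg : gradient θ x = 0 := by
        by_contra h'
        exact hx (support_gradient_subset θ h')
      simp [image_eq_zero_of_notMem_tsupport hx, hg]
  have mF : AEStronglyMeasurable (fun x => F (v x)) volume :=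
    hFc.comp_aestronglyMeasurable i1.aestronglyMeasurable
  have mF' : AEStronglyMeasurable (fun x => F' (v x)) volume :=
    hF'.comp_aestronglyMeasurable i1.aestronglyMeasurable
  obtain ⟨C, hC⟩ := (isCompact_Icc (a := -(Cη * |B|)) (b := Cη * |B|)).exists_bound_of_continuousOn
    hFc.continuousOn
  obtain ⟨C', hC'⟩ := (isCompact_Icc (a := -(Cη * |B|)) (b := Cη * |B|)).exists_bound_of_continuousOn
    hF'.continuousOn
  obtain ⟨D, hD⟩ := hθ.continuous.bounded_above_of_compact_support hθc
  have k1 : Integrable (fun x => F (u x) * θ x) volume := by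
    simp_rw [← p1]
    refine (hθ.continuous.integrable_of_hasCompactSupport hθc).bdd_mul (c := C) mF ?_
    filter_upwards [hvB] with x hx using hC _ (abs_le.1 hx)
  have hgc : HasCompactSupport (gradient θ) := hθc.mono' (support_gradient_subset θ)
  have k2 : Integrable (fun x => (F' (u x) * θ x) • V x + F (u x) • gradient θ x) volume := by
    simp_rw [← p2]
    refine Integrable.add ?_ ?_
    · have : Integrable (fun x => θ x • W x) volume :=
        i2.bdd_smul D hθ.continuous.aestronglyMeasurable (Eventually.of_forall hD)
      simp_rw [mul_smul]
      refine this.bdd_smul C' mF' ?_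
      filter_upwards [hvB] with x hx using hC' _ (abs_le.1 hx)
    · refine ((continuous_gradient hθ).integrable_of_hasCompactSupport hgc).bdd_smul C mF ?_
      filter_upwards [hvB] with x hx using hC _ (abs_le.1 hx)
  refine ⟨k1, k2, k1.locallyIntegrable.locallyIntegrableOn _,
    k2.locallyIntegrable.locallyIntegrableOn _, fun ψ hψ _ _ e => ?_⟩
  have := integral_comp_mul_fderiv i1 i2 hw hvB hF hF' hθ hθc hψ e
  simp_rw [p1, p2] at this
  simpa only [Measure.restrict_univ] using this

/-! ### Sobolev inequality for weak gradients. -/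

/-- Gagliardo–Nirenberg–Sobolev inequality in `W^{1,1}` for functions with compact support. -/
theorem lintegral_rpow_le_of_isWeakGradient {n : ℕ} {p : ℝ} (hp : Real.HolderConjugate n p)
    {v : EuclideanSpace ℝ (Fin n) → ℝ} {W : EuclideanSpace ℝ (Fin n) → EuclideanSpace ℝ (Fin n)}
    (hv : Integrable v volume) (hW : Integrable W volume) (h : IsWeakGradient univ v W)
    (hc : HasCompactSupport v) :
    ∫⁻ x, ‖v x‖ₑ ^ p ≤ lintegralPowLePowLIntegralFDerivConst
      (volume : Measure (EuclideanSpace ℝ (Fin n))) p * (∫⁻ x, ‖W x‖ₑ) ^ p := by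
  have hp0 : 0 < p := hp.symm.pos
  have hfd : ∀ k x, ‖fderiv ℝ (mollify k v) x‖ₑ = ‖mollify k W x‖ₑ := by
    intro k x
    have : fderiv ℝ (mollify k v) x = innerSL ℝ (mollify k W x) := by
      ext e
      rw [fderiv_mollify hv hW h, innerSL_apply_apply]
    rw [this, ← ofReal_norm, ← ofReal_norm, innerSL_apply_norm]
  have hle : ∀ k, ∫⁻ x, ‖mollify k W x‖ₑ ≤ ∫⁻ x, ‖W x‖ₑ := by
    intro k
    rw [← ofReal_integral_norm_eq_lintegral_enorm (integrable_mollify k hW),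
      ← ofReal_integral_norm_eq_lintegral_enorm hW]
    refine ENNReal.ofReal_le_ofReal ?_
    rw [← integral_mollify k hW.norm]
    exact integral_mono (integrable_mollify k hW).norm (integrable_mollify k hW.norm)
      fun x => norm_mollify_le k W x
  have hk : ∀ k, ∫⁻ x, ‖mollify k v x‖ₑ ^ p ≤ lintegralPowLePowLIntegralFDerivConst
      (volume : Measure (EuclideanSpace ℝ (Fin n))) p * (∫⁻ x, ‖W x‖ₑ) ^ p := by
    intro k
    refine (lintegral_pow_le_pow_lintegral_fderiv volume
      ((contDiff_mollify k hv.locallyIntegrable).of_le (by simp))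
      (hasCompactSupport_mollify k hc) (by simpa using hp)).trans ?_
    simp_rw [hfd]
    exact mul_le_mul' le_rfl (ENNReal.rpow_le_rpow (hle k) hp0.le)
  -- Fatou's lemma; the bound is uniform in k because mollification does not increase the L¹ norm of
  -- `W`.
  calc ∫⁻ x, ‖v x‖ₑ ^ p = ∫⁻ x, liminf (fun k => ‖mollify k v x‖ₑ ^ p) atTop := by
        refine lintegral_congr_ae ?_
        filter_upwards [ae_tendsto_mollify hv.locallyIntegrable] with x hx
        exact ((ENNReal.continuous_rpow_const.tendsto _).comp hx.enorm).liminf_eq.symm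
    _ ≤ liminf (fun k => ∫⁻ x, ‖mollify k v x‖ₑ ^ p) atTop := by
        refine lintegral_liminf_le fun k => ?_
        exact ((contDiff_mollify k hv.locallyIntegrable).continuous.measurable.enorm.pow_const p)
    _ ≤ _ := liminf_le_of_frequently_le' (Frequently.of_forall hk)

/-! ### Cutoff functions and measurability of superpositions. -/

theorem exists_bound_deriv_smoothTransition :
    ∃ L : ℝ, ∀ t, |deriv Real.smoothTransition t| ≤ L := by
  have hc : Continuous (deriv Real.smoothTransition) :=
    (Real.smoothTransition.contDiff (n := 1)).continuous_deriv (by simp)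
  obtain ⟨L, hL⟩ := (isCompact_Icc (a := (0 : ℝ)) (b := 1)).exists_bound_of_continuousOn
    hc.continuousOn
  refine ⟨L, fun t => ?_⟩
  have h0 : 0 ≤ L := (norm_nonneg _).trans (hL 0 (by simp))
  by_cases ht : t ∈ Icc (0 : ℝ) 1
  · exact hL t ht
  · have hz : deriv Real.smoothTransition t = 0 := by
      rw [mem_Icc, not_and_or, not_le, not_le] at ht
      rcases ht with ht | ht
      · have : Real.smoothTransition =ᶠ[𝓝 t] fun _ => (0 : ℝ) := by
          filter_upwards [Iio_mem_nhds ht] with s hs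
          exact Real.smoothTransition.zero_of_nonpos (le_of_lt hs)
        rw [this.deriv_eq, deriv_const]
      · have : Real.smoothTransition =ᶠ[𝓝 t] fun _ => (1 : ℝ) := by
          filter_upwards [Ioi_mem_nhds ht] with s hs
          exact Real.smoothTransition.one_of_one_le (le_of_lt hs)
        rw [this.deriv_eq, deriv_const]
    rw [hz, abs_zero]
    exact h0

/-- Smooth cutoff functions between concentric balls, with the optimal gradient bound. -/
theorem exists_cutoff : ∃ L : ℝ, 1 ≤ L ∧ ∀ (n : ℕ) (x₀ : EuclideanSpace ℝ (Fin n)) (r R : ℝ),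
    0 < r → r < R → ∃ ζ : EuclideanSpace ℝ (Fin n) → ℝ, ContDiff ℝ ∞ ζ ∧
      (∀ x, 0 ≤ ζ x) ∧ (∀ x, ζ x ≤ 1) ∧ (∀ x ∈ Metric.closedBall x₀ r, ζ x = 1) ∧
      tsupport ζ ⊆ Metric.closedBall x₀ R ∧ (∀ x, x ∉ Metric.ball x₀ R → ζ x = 0) ∧
      ∀ x, ‖gradient ζ x‖ ≤ L / (R - r) := by
  obtain ⟨L₀, hL₀⟩ := exists_bound_deriv_smoothTransition
  have hL0 : 0 ≤ L₀ := (abs_nonneg _).trans (hL₀ 0)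
  refine ⟨2 * L₀ + 1, by linarith, fun n x₀ r R hr hrR => ?_⟩
  have hd : 0 < R ^ 2 - r ^ 2 := by nlinarith
  -- The squared distance is smooth at the centre, and R² - r² = (R - r)(R + r) yields |∇a| ≤ 2/(R -
  -- r) on the ball of radius R.
  set a : EuclideanSpace ℝ (Fin n) → ℝ := fun x => (R ^ 2 - ‖x - x₀‖ ^ 2) / (R ^ 2 - r ^ 2) with ha
  have ha_smooth : ContDiff ℝ ∞ a :=
    (contDiff_const.sub ((contDiff_id.sub contDiff_const).norm_sq ℝ)).div_const _
  have hzero : ∀ x, R ≤ ‖x - x₀‖ → Real.smoothTransition (a x) = 0 := by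
    intro x hx
    refine Real.smoothTransition.zero_of_nonpos (div_nonpos_of_nonpos_of_nonneg ?_ hd.le)
    nlinarith
  refine ⟨fun x => Real.smoothTransition (a x), Real.smoothTransition.contDiff.comp ha_smooth,
    fun x => Real.smoothTransition.nonneg _, fun x => Real.smoothTransition.le_one _,
    fun x hx => ?_, ?_, fun x hx => ?_, fun x => ?_⟩
  · refine Real.smoothTransition.one_of_one_le ?_
    rw [mem_closedBall_iff_norm] at hx
    rw [ha, le_div_iff₀ hd]
    nlinarith [norm_nonneg (x - x₀)]
  · refine closure_minimal (fun x hx => ?_) Metric.isClosed_closedBall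
    rw [mem_closedBall_iff_norm]
    by_contra h
    exact hx (hzero x (not_le.1 h).le)
  · rw [mem_ball_iff_norm, not_lt] at hx
    exact hzero x hx
  · rw [norm_gradient_eq]
    have h1 : HasFDerivAt a ((R ^ 2 - r ^ 2)⁻¹ • (-((2 : ℕ) • innerSL ℝ (x - x₀)) : EuclideanSpace ℝ (Fin n) →L[ℝ] ℝ)) x := by
      have := (((hasFDerivAt_id x).sub_const x₀).norm_sq.const_sub (R ^ 2)).mul_const
        (R ^ 2 - r ^ 2)⁻¹
      simpa [ha, div_eq_mul_inv] using this
    have h2 : HasDerivAt Real.smoothTransition (deriv Real.smoothTransition (a x)) (a x) :=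
      ((Real.smoothTransition.contDiff (n := 1)).differentiable (by simp) _).hasDerivAt
    have h3 : HasFDerivAt (fun x => Real.smoothTransition (a x)) _ x := h2.comp_hasFDerivAt x h1
    have hRr : 0 < R - r := by linarith
    rcases lt_or_ge R ‖x - x₀‖ with hx | hx
    · have : (fun x => Real.smoothTransition (a x)) =ᶠ[𝓝 x] fun _ => (0 : ℝ) := by
        have ho : IsOpen {y : EuclideanSpace ℝ (Fin n) | R < ‖y - x₀‖} :=
          isOpen_lt continuous_const (continuous_id.sub continuous_const).norm
        filter_upwards [ho.mem_nhds hx] with y hy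
        exact hzero y (le_of_lt hy)
      rw [this.fderiv_eq]
      simp only [fderiv_fun_const, Pi.zero_apply, norm_zero]
      positivity
    · rw [h3.fderiv, norm_smul, norm_smul, norm_neg, ← Nat.cast_smul_eq_nsmul ℝ, norm_smul,
        innerSL_apply_norm, norm_inv, Real.norm_of_nonneg hd.le, Real.norm_eq_abs]
      have e1 : (R ^ 2 - r ^ 2)⁻¹ * (‖((2 : ℕ) : ℝ)‖ * ‖x - x₀‖) ≤ 2 / (R - r) := by
        rw [inv_mul_eq_div, div_le_div_iff₀ hd hRr]
        have : ‖((2 : ℕ) : ℝ)‖ = 2 := by norm_num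
        rw [this]
        nlinarith
      calc _ ≤ L₀ * (2 / (R - r)) := by
            refine mul_le_mul (hL₀ _) e1 (by positivity) hL0
        _ ≤ _ := by
            rw [← mul_div_assoc]
            gcongr
            linarith

/-- Carathéodory functions are superpositionally measurable. -/
theorem aestronglyMeasurable_superposition {α : Type*} [MeasurableSpace α] {μ : Measure α}
    {g : α → ℝ → ℝ} {f : α → ℝ} (hg : ∀ v, 0 ≤ v → AEStronglyMeasurable (fun x => g x v) μ)
    (hc : ∀ᵐ x ∂μ, ContinuousOn (g x) (Ici 0)) (hf : AEMeasurable f μ) (hf0 : ∀ x, 0 ≤ f x) :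
    AEStronglyMeasurable (fun x => g x (f x)) μ := by
  -- After rounding, `f` takes only the countably many values j/(k+1), so passing to measurable
  -- representatives of g(·, j/(k+1)) discards countably many null sets.
  have hstep : ∀ k : ℕ, AEStronglyMeasurable
      (fun x => g x ((⌊((k : ℝ) + 1) * f x⌋₊ : ℝ) / ((k : ℝ) + 1))) μ := by
    intro k
    have hj : ∀ j : ℕ, ∃ G : α → ℝ, Measurable G ∧
        ∀ᵐ x ∂μ, g x ((j : ℝ) / ((k : ℝ) + 1)) = G x := fun j => by
      obtain ⟨G, hG, hGe⟩ := hg ((j : ℝ) / ((k : ℝ) + 1)) (by positivity)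
      exact ⟨G, hG.measurable, hGe⟩
    choose G hG hGe using hj
    obtain ⟨f', hf', hfe⟩ := hf
    have hN : Measurable fun x => ⌊((k : ℝ) + 1) * f' x⌋₊ :=
      Nat.measurable_floor.comp (hf'.const_mul _)
    have hm : Measurable fun z : ℕ × α => G z.1 z.2 := measurable_from_prod_countable_right hG
    have hm2 : Measurable fun x => G ⌊((k : ℝ) + 1) * f' x⌋₊ x :=
      hm.comp (hN.prodMk measurable_id)
    refine ⟨_, hm2.stronglyMeasurable, ?_⟩
    filter_upwards [ae_all_iff.2 hGe, hfe] with x hx hfx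
    rw [hx, hfx]
  refine aestronglyMeasurable_of_tendsto_ae atTop hstep ?_
  filter_upwards [hc] with x hx
  have hlim : Tendsto (fun k : ℕ => (⌊((k : ℝ) + 1) * f x⌋₊ : ℝ) / ((k : ℝ) + 1)) atTop
      (𝓝 (f x)) := by
    have h1 : Tendsto (fun k : ℕ => (k : ℝ) + 1) atTop atTop :=
      tendsto_atTop_add_const_right _ _ tendsto_natCast_atTop_atTop
    have := (tendsto_nat_floor_mul_div_atTop (hf0 x)).comp h1
    simpa [Function.comp_def, mul_comm] using this
  have hlim2 : Tendsto (fun k : ℕ => (⌊((k : ℝ) + 1) * f x⌋₊ : ℝ) / ((k : ℝ) + 1)) atTop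
      (𝓝[Ici 0] (f x)) :=
    tendsto_nhdsWithin_iff.2 ⟨hlim, Eventually.of_forall fun k => by
      show (0 : ℝ) ≤ _
      positivity⟩
  exact (hx (f x) (hf0 x)).tendsto.comp hlim2

/-! ### Growth inequalities at a fixed point. -/

/-- The growth conditions `(g₁)`, `(g₂)` at one point, for a function `G = g(x, ·)`. -/
structure Growth (c₁ q b₀ p : ℝ) (G : ℝ → ℝ) : Prop where
  one_lt_q : 1 < q
  one_lt_p : 1 < p
  c₁_pos : 0 < c₁
  b₀_nonneg : 0 ≤ b₀
  pos : ∀ v, 0 < v → 0 < G v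
  mono : ∀ v w, 0 < v → v ≤ w → G v ≤ G w
  upper : ∀ v w, 0 < v → b₀ ≤ v → v ≤ w → G w ≤ c₁ * (w / v) ^ (q - 1) * G v
  lower : ∀ v w, 0 < v → v ≤ w → (w / v) ^ (p - 1) * G v ≤ G w

/-- Equal arguments in (g₂) force positivity, since division by zero gives 0 < 1. Monotonicity is
also drawn from (g₂): condition (g) supplies it only for almost every x, while the estimate concerns
the particular point x₀. -/
theorem growth_of_cond {n : ℕ} {Ω : Set (EuclideanSpace ℝ (Fin n))}
    {g : EuclideanSpace ℝ (Fin n) → ℝ → ℝ} {c₁ q b₀ p : ℝ} (hg : CondG Ω g)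
    (hg1 : CondG1 Ω g c₁ q b₀) (hg2 : CondG2 Ω g p) {x : EuclideanSpace ℝ (Fin n)} (hx : x ∈ Ω) :
    Growth c₁ q b₀ p (g x) := by
  obtain ⟨hc, hq, hb, h1⟩ := hg1
  obtain ⟨hp, h2⟩ := hg2
  have hpos : ∀ v, 0 < v → 0 < g x v := by
    intro v hv
    have := h2 x hx v v hv le_rfl
    rw [div_self hv.ne', Real.one_rpow] at this
    refine lt_of_le_of_ne (hg.1 x hx v hv.le) fun h => ?_
    rw [← h, div_zero] at this
    linarith
  have hlow : ∀ v w, 0 < v → v ≤ w → (w / v) ^ (p - 1) * g x v ≤ g x w := fun v w hv hvw =>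
    (le_div_iff₀ (hpos v hv)).1 (h2 x hx v w hv hvw)
  refine ⟨hq, hp, hc, hb, hpos, fun v w hv hvw => ?_, fun v w hv hbv hvw =>
    (div_le_iff₀ (hpos v hv)).1 (h1 x hx v w hv hbv hvw), hlow⟩
  refine le_trans ?_ (hlow v w hv hvw)
  have : 1 ≤ (w / v) ^ (p - 1) :=
    Real.one_le_rpow ((one_le_div hv).2 hvw) (by linarith)
  nlinarith [hpos v hv]

theorem Growth.one_le_c₁ {c₁ q b₀ p : ℝ} {G : ℝ → ℝ} (h : Growth c₁ q b₀ p G) : 1 ≤ c₁ := by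
  have hb := h.b₀_nonneg
  have := h.upper (b₀ + 1) (b₀ + 1) (by linarith) (by linarith) le_rfl
  rw [div_self (by linarith), Real.one_rpow, mul_one] at this
  exact le_of_mul_le_mul_right (by linarith) (h.pos (b₀ + 1) (by linarith))

/-- Young's inequality for the right-hand side of the Caccioppoli inequality. -/
theorem Growth.young {c₁ q b₀ p : ℝ} {G : ℝ → ℝ} (h : Growth c₁ q b₀ p G)
    {T m ρ ζ H y : ℝ} {s : ℕ} (hT0 : 0 ≤ T) (hTm : T ≤ m) (hm : 0 < m) (hρ : 0 < ρ)
    (hζ0 : 0 ≤ ζ) (hζ1 : ζ ≤ 1) (hH : 1 ≤ H) (hs : q ≤ s) (hb : b₀ ≤ m / ρ) (hy : 0 < y) :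
    G y * T ^ 2 * (s * ζ ^ (s - 1) * (H / ρ)) ≤
      1 / 2 * (G y * y * (2 * T * ζ ^ s)) + c₁ * (s * H) ^ s * G (m / ρ) * (m / ρ) * T := by
  have hq := h.one_lt_q
  have hs1 : (1 : ℝ) < s := lt_of_lt_of_le hq hs
  have hs2 : 2 ≤ s := by exact_mod_cast hs1
  have hmρ : 0 < m / ρ := div_pos hm hρ
  have hGm := h.pos _ hmρ
  have hGy := h.pos _ hy
  have hc := h.c₁_pos
  rcases hζ0.eq_or_lt with hζ | hζ
  · rw [← hζ, zero_pow (by omega), zero_pow (by omega)]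
    have : 0 ≤ c₁ * (s * H) ^ s * G (m / ρ) * (m / ρ) * T := by positivity
    simpa using this
  have hpow : ζ ^ s = ζ ^ (s - 1) * ζ := by
    rw [← pow_succ]; congr 1; omega
  -- The threshold at which the two terms balance: the left side is G(y) T ζ^s b. If b ≤ y this is
  -- at most half of the energy term. If y ≤ b, then y is at most (m/ρ)(sH/ζ) and (g₁) applies.
  set b : ℝ := T * (s * H) / (ρ * ζ) with hbdef
  have e1 : G y * T ^ 2 * (s * ζ ^ (s - 1) * (H / ρ)) = G y * T * ζ ^ s * b := by
    rw [hpow, hbdef]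
    field_simp
  rw [e1]
  have hb0 : 0 ≤ b := by positivity
  rcases le_total b y with hby | hby
  · have h1 : G y * T * ζ ^ s * b ≤ G y * T * ζ ^ s * y :=
      mul_le_mul_of_nonneg_left hby (by positivity)
    have h2 : 0 ≤ c₁ * (s * H) ^ s * G (m / ρ) * (m / ρ) * T := by positivity
    nlinarith
  · have hD : 1 ≤ s * H / ζ := by
      rw [one_le_div hζ]
      nlinarith
    have hbD : b ≤ m / ρ * (s * H / ζ) := by
      rw [hbdef, div_mul_div_comm]
      gcongr
    have g1 : G y ≤ c₁ * (s * H / ζ) ^ (q - 1) * G (m / ρ) := by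
      refine (h.mono y _ hy (hby.trans hbD)).trans ?_
      refine (h.upper (m / ρ) _ hmρ hb (le_mul_of_one_le_right hmρ.le hD)).trans (le_of_eq ?_)
      rw [mul_div_cancel_left₀ _ hmρ.ne']
    -- (g₁) costs q - 1 powers of 1/ζ and `b` one more; since s ≥ q, the factor ζ^s pays for them.
    have g2 : (s * H / ζ) ^ (q - 1) * (s * H / ζ) * ζ ^ s ≤ (s * H) ^ s := by
      have hD0 : 0 < s * H / ζ := by linarith
      have : (s * H / ζ) ^ (q - 1) * (s * H / ζ) ≤ (s * H / ζ) ^ s := by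
        rw [← Real.rpow_add_one hD0.ne', sub_add_cancel, ← Real.rpow_natCast]
        exact Real.rpow_le_rpow_of_exponent_le hD hs
      calc _ ≤ (s * H / ζ) ^ s * ζ ^ s := by gcongr
        _ = _ := by rw [← mul_pow, div_mul_cancel₀ _ hζ.ne']
    have h2 : 0 ≤ G y * y * (2 * T * ζ ^ s) := by positivity
    calc G y * T * ζ ^ s * b
        ≤ (c₁ * (s * H / ζ) ^ (q - 1) * G (m / ρ)) * T * ζ ^ s * (m / ρ * (s * H / ζ)) := by
          gcongr
      _ = c₁ * ((s * H / ζ) ^ (q - 1) * (s * H / ζ) * ζ ^ s) * G (m / ρ) * (m / ρ) * T := by ring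
      _ ≤ c₁ * (s * H) ^ s * G (m / ρ) * (m / ρ) * T := by gcongr
      _ ≤ _ := by linarith

/-- The energy density controls the gradient up to a term without derivatives. -/
theorem Growth.gradient_le {c₁ q b₀ p : ℝ} {G : ℝ → ℝ} (h : Growth c₁ q b₀ p G)
    {T z A₀ κ a y : ℝ} (hT0 : 0 ≤ T) (hz0 : 0 ≤ z) (hz1 : z ≤ 1) (ha : 0 < a) (hA : 0 < A₀)
    (hκ : A₀ ≤ κ * G a) (hy : 0 ≤ y) (hκ0 : 0 < κ) (hGy : 0 ≤ G y) :
    2 * T * z * y ≤ κ / A₀ * (G y * y * (2 * T * z)) + 2 * T * a := by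
  have e0 : 0 ≤ κ / A₀ * (G y * y * (2 * T * z)) := by positivity
  -- For y ≥ a, G(y) ≥ G(a) ≥ A₀/κ, so the energy pays for the gradient. For y ≤ a the gradient is
  -- bounded outright.
  rcases le_total a y with hay | hay
  · have h1 : A₀ ≤ κ * G y := hκ.trans (mul_le_mul_of_nonneg_left (h.mono a y ha hay) hκ0.le)
    have h2 : 1 ≤ κ / A₀ * G y := by
      rw [div_mul_eq_mul_div, one_le_div hA]
      exact h1
    have h3 : 0 ≤ 2 * T * z * y := by positivity
    have h4 : 0 ≤ 2 * T * a := by positivity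
    nlinarith
  · have : 2 * T * z * y ≤ 2 * T * 1 * a := by gcongr
    linarith

/-! ### Truncations of the solution as test functions. -/

/-- Squaring makes the truncation continuously differentiable, so the chain rule for C¹ functions
suffices. -/
theorem hasDerivAt_posPart_sq (a t : ℝ) :
    HasDerivAt (fun t => max (t - a) 0 ^ 2) (2 * max (t - a) 0) t := by
  rcases lt_trichotomy t a with h | h | h
  · have : (fun t => max (t - a) 0 ^ 2) =ᶠ[𝓝 t] fun _ => (0 : ℝ) := by
      filter_upwards [Iio_mem_nhds h] with s hs
      rw [max_eq_right (by linarith [mem_Iio.1 hs])]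
      norm_num
    rw [max_eq_right (by linarith), mul_zero]
    exact (hasDerivAt_const t (0 : ℝ)).congr_of_eventuallyEq this
  · subst h
    rw [sub_self, max_self, mul_zero, hasDerivAt_iff_isLittleO]
    simp only [sub_self, max_self, smul_zero, sub_zero]
    refine Asymptotics.IsBigO.trans_isLittleO (g := fun x => (x - t) ^ 2) ?_ ?_
    · refine Asymptotics.isBigO_of_le _ fun x => ?_
      have key : ‖max (x - t) 0 ^ 2‖ ≤ ‖(x - t) ^ 2‖ := by
        rw [Real.norm_of_nonneg (sq_nonneg _), Real.norm_of_nonneg (sq_nonneg _)]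
        rcases le_total (x - t) 0 with h | h
        · rw [max_eq_right h]
          nlinarith
        · rw [max_eq_left h]
      simpa using key
    · have := (Asymptotics.isLittleO_pow_id (𝕜 := ℝ) one_lt_two).comp_tendsto
        (show Tendsto (fun x => x - t) (𝓝 t) (𝓝 0) by
          have : Tendsto (fun x => x - t) (𝓝 t) (𝓝 (t - t)) :=
            (continuous_id.sub continuous_const).tendsto t
          rwa [sub_self] at this)
      exact this
  · have : (fun t => max (t - a) 0 ^ 2) =ᶠ[𝓝 t] fun t => (t - a) ^ 2 := by
      filter_upwards [Ioi_mem_nhds h] with s hs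
      rw [max_eq_left (by linarith [mem_Ioi.1 hs])]
    rw [max_eq_left (by linarith)]
    have h2 : HasDerivAt (fun t => (t - a) ^ 2) _ t := ((hasDerivAt_id t).sub_const a).fun_pow 2
    refine HasDerivAt.congr_of_eventuallyEq ?_ this
    simpa using h2

/-- `u`, with weak gradient `V` and `|u| ≤ B`, is a weak solution for a nonlinearity `g` subject to
`(g)`, `(g₁)`, `(g₂)`. -/
structure SolutionData {n : ℕ} (Ω : Set (EuclideanSpace ℝ (Fin n)))
    (g : EuclideanSpace ℝ (Fin n) → ℝ → ℝ) (c₁ q b₀ p : ℝ) (u : EuclideanSpace ℝ (Fin n) → ℝ)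
    (V : EuclideanSpace ℝ (Fin n) → EuclideanSpace ℝ (Fin n)) (B : ℝ) : Prop where
  isOpen : IsOpen Ω
  condG : CondG Ω g
  growth : ∀ x ∈ Ω, Growth c₁ q b₀ p (g x)
  memLoc : MemW1GLoc Ω g u V
  bound : ∀ᵐ x ∂(volume.restrict Ω), |u x| ≤ B
  weak_eq : ∀ (φ : EuclideanSpace ℝ (Fin n) → ℝ)
    (Φ : EuclideanSpace ℝ (Fin n) → EuclideanSpace ℝ (Fin n)), MemW1GZero Ω g φ Φ →
    ∫ x in Ω, inner ℝ ((g x ‖V x‖ / ‖V x‖) • V x) (Φ x) = 0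

/-- A doubling property, used to show that test functions have finite energy. The maximum with b₀ +
1 moves the argument into the range where (g₁) holds. -/
theorem Growth.mul_le_of_le_mul_max {c₁ q b₀ p : ℝ} {G : ℝ → ℝ} (h : Growth c₁ q b₀ p G)
    {N y z : ℝ} (hN : 1 ≤ N) (hy : 0 ≤ y) (hz : 0 ≤ z) (hzN : z ≤ N * max y (b₀ + 1)) :
    G z * z ≤ c₁ * N ^ (q - 1) * N * (G y * y + G (b₀ + 1) * (b₀ + 1)) := by
  have hb := h.b₀_nonneg
  have hc := h.c₁_pos
  have hb1 : 0 < G (b₀ + 1) * (b₀ + 1) := mul_pos (h.pos _ (by linarith)) (by linarith)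
  have hyy : 0 ≤ G y * y := by
    rcases hy.eq_or_lt with h0 | h0
    · simp [← h0]
    · exact (mul_pos (h.pos _ h0) h0).le
  have hN0 : 0 < N := by linarith
  have hNq : 0 < N ^ (q - 1) := Real.rpow_pos_of_pos hN0 _
  rcases hz.eq_or_lt with h0 | h0
  · rw [← h0, mul_zero]
    positivity
  set w := max y (b₀ + 1) with hw
  have hw0 : 0 < w := lt_of_lt_of_le (by linarith) (le_max_right y (b₀ + 1))
  have hwb : b₀ ≤ w := le_trans (by linarith) (le_max_right y (b₀ + 1))
  have h1 : G z ≤ c₁ * N ^ (q - 1) * G w := by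
    refine (h.mono z _ h0 hzN).trans ((h.upper w (N * w) hw0 hwb
      (le_mul_of_one_le_left hw0.le hN)).trans (le_of_eq ?_))
    rw [mul_div_cancel_right₀ _ hw0.ne']
  have h2 : G w * w ≤ G y * y + G (b₀ + 1) * (b₀ + 1) := by
    rcases max_choice y (b₀ + 1) with h | h <;> rw [hw, h] <;> linarith
  have hGw := h.pos w hw0
  calc G z * z ≤ (c₁ * N ^ (q - 1) * G w) * (N * w) := by gcongr
    _ = c₁ * N ^ (q - 1) * N * (G w * w) := by ring
    _ ≤ _ := by gcongr

theorem gradient_pow {n : ℕ} {ζ : EuclideanSpace ℝ (Fin n) → ℝ} (hζ : ContDiff ℝ ∞ ζ) (s : ℕ)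
    (x : EuclideanSpace ℝ (Fin n)) :
    gradient (fun x => ζ x ^ s) x = (s * ζ x ^ (s - 1)) • gradient ζ x := by
  have h := (hζ.differentiable (by simp) x).hasFDerivAt.pow s
  have h' : HasFDerivAt (fun x => ζ x ^ s) _ x := h
  rw [gradient, h'.fderiv, gradient, map_smul]
  simp

theorem IsWeakGradient.restrict {n : ℕ} {Ω : Set (EuclideanSpace ℝ (Fin n))}
    {φ : EuclideanSpace ℝ (Fin n) → ℝ} {Φ : EuclideanSpace ℝ (Fin n) → EuclideanSpace ℝ (Fin n)}
    (h : IsWeakGradient univ φ Φ) (hφ : ∀ x, x ∉ Ω → φ x = 0) (hΦ : ∀ x, x ∉ Ω → Φ x = 0) :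
    IsWeakGradient Ω φ Φ := by
  refine ⟨h.1.mono_set (subset_univ _), h.2.1.mono_set (subset_univ _),
    fun ψ hψ hψc _ e => ?_⟩
  have := h.2.2 ψ hψ hψc (subset_univ _) e
  simp only [Measure.restrict_univ] at this
  rwa [setIntegral_eq_integral_of_forall_compl_eq_zero (fun x hx => by simp [hφ x hx]),
    setIntegral_eq_integral_of_forall_compl_eq_zero (fun x hx => by simp [hΦ x hx])]

/-- The weighted superlevel function `((u - a)_+)² ζ^s` used as a test function. -/
noncomputable def levelFun {n : ℕ} (u ζ : EuclideanSpace ℝ (Fin n) → ℝ) (a : ℝ) (s : ℕ)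
    (x : EuclideanSpace ℝ (Fin n)) : ℝ :=
  max (u x - a) 0 ^ 2 * ζ x ^ s

/-- The weak gradient of `levelFun`. -/
noncomputable def levelGrad {n : ℕ} (u ζ : EuclideanSpace ℝ (Fin n) → ℝ)
    (V : EuclideanSpace ℝ (Fin n) → EuclideanSpace ℝ (Fin n)) (a : ℝ) (s : ℕ)
    (x : EuclideanSpace ℝ (Fin n)) : EuclideanSpace ℝ (Fin n) :=
  (2 * max (u x - a) 0 * ζ x ^ s) • V x +
    max (u x - a) 0 ^ 2 • ((s * ζ x ^ (s - 1)) • gradient ζ x)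

/-- The gap between R and R₁ leaves room for a second cutoff, equal to 1 on the support of ζ, which
carries `u` to the whole space before the chain rule is applied. -/
theorem isWeakGradient_level {n : ℕ} {Ω : Set (EuclideanSpace ℝ (Fin n))}
    {g : EuclideanSpace ℝ (Fin n) → ℝ → ℝ} {c₁ q b₀ p : ℝ} {u : EuclideanSpace ℝ (Fin n) → ℝ}
    {V : EuclideanSpace ℝ (Fin n) → EuclideanSpace ℝ (Fin n)} {B : ℝ}
    (S : SolutionData Ω g c₁ q b₀ p u V B)
    {x₀ : EuclideanSpace ℝ (Fin n)} {R R₁ : ℝ} (hR : 0 < R) (hRR : R < R₁)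
    (hΩ : Metric.closedBall x₀ R₁ ⊆ Ω) {ζ : EuclideanSpace ℝ (Fin n) → ℝ}
    (hζ : ContDiff ℝ ∞ ζ) (hζs : tsupport ζ ⊆ Metric.closedBall x₀ R) (a : ℝ) {s : ℕ}
    (hs : s ≠ 0) :
    Integrable (levelFun u ζ a s) volume ∧ Integrable (levelGrad u ζ V a s) volume ∧
      IsWeakGradient univ (levelFun u ζ a s) (levelGrad u ζ V a s) := by
  obtain ⟨L, _, hL⟩ := exists_cutoff
  obtain ⟨η, hη, -, -, hη1, hηs, -, -⟩ := hL n x₀ R R₁ hR hRR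
  have hts : tsupport (fun x => ζ x ^ s) ⊆ tsupport ζ := by
    refine closure_mono fun x hx => ?_
    intro h0
    apply hx
    simp [h0, hs]
  have hζc : HasCompactSupport (fun x => ζ x ^ s) :=
    HasCompactSupport.of_support_subset_isCompact (isCompact_closedBall x₀ R)
      ((subset_tsupport _).trans (hts.trans hζs))
  have hηc : HasCompactSupport η :=
    HasCompactSupport.of_support_subset_isCompact (isCompact_closedBall x₀ R₁)
      ((subset_tsupport _).trans hηs)
  have h := S.memLoc.1.comp_mul S.isOpen.measurableSet S.bound (hasDerivAt_posPart_sq a)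
    (by fun_prop) hη hηc (hηs.trans hΩ) (hζ.pow s) hζc (fun x hx => hη1 x (hζs (hts hx)))
  have e : (fun x => (2 * max (u x - a) 0 * ζ x ^ s) • V x +
      max (u x - a) 0 ^ 2 • gradient (fun x => ζ x ^ s) x) = levelGrad u ζ V a s := by
    ext1 x
    rw [gradient_pow hζ, levelGrad]
  rw [e] at h
  exact h

theorem norm_levelGrad_le {n : ℕ} {u ζ : EuclideanSpace ℝ (Fin n) → ℝ}
    {V : EuclideanSpace ℝ (Fin n) → EuclideanSpace ℝ (Fin n)} {a D : ℝ} {s : ℕ}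
    (hζ0 : ∀ x, 0 ≤ ζ x) (hD : ∀ x, ‖gradient ζ x‖ ≤ D) (x : EuclideanSpace ℝ (Fin n)) :
    ‖levelGrad u ζ V a s x‖ ≤ 2 * max (u x - a) 0 * ζ x ^ s * ‖V x‖ +
      max (u x - a) 0 ^ 2 * (s * ζ x ^ (s - 1) * D) := by
  have hT : 0 ≤ max (u x - a) 0 := le_max_right _ _
  have hz := hζ0 x
  refine (norm_add_le _ _).trans (add_le_add (le_of_eq ?_) ?_)
  · rw [norm_smul, Real.norm_of_nonneg (by positivity)]
  · rw [norm_smul, norm_smul, Real.norm_of_nonneg (by positivity),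
      Real.norm_of_nonneg (by positivity)]
    gcongr
    exact hD x

/-- The test function built from a solution is admissible. -/
theorem memW1GZero_level {n : ℕ} {Ω : Set (EuclideanSpace ℝ (Fin n))}
    {g : EuclideanSpace ℝ (Fin n) → ℝ → ℝ} {c₁ q b₀ p : ℝ} {u : EuclideanSpace ℝ (Fin n) → ℝ}
    {V : EuclideanSpace ℝ (Fin n) → EuclideanSpace ℝ (Fin n)} {B : ℝ}
    (S : SolutionData Ω g c₁ q b₀ p u V B)
    {x₀ : EuclideanSpace ℝ (Fin n)} {R R₁ : ℝ} (hR : 0 < R) (hRR : R < R₁)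
    (hΩ : Metric.closedBall x₀ R₁ ⊆ Ω) {ζ : EuclideanSpace ℝ (Fin n) → ℝ}
    (hζ : ContDiff ℝ ∞ ζ) (hζ0 : ∀ x, 0 ≤ ζ x) (hζ1 : ∀ x, ζ x ≤ 1)
    (hζs : tsupport ζ ⊆ Metric.closedBall x₀ R) (hζz : ∀ x, x ∉ Metric.ball x₀ R → ζ x = 0)
    {a m D : ℝ} (hD : ∀ x, ‖gradient ζ x‖ ≤ D)
    (hTm : ∀ᵐ x ∂(volume.restrict (Metric.ball x₀ R)), max (u x - a) 0 ≤ m) {s : ℕ} (hs : 2 ≤ s) :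
    MemW1GZero Ω g (levelFun u ζ a s) (levelGrad u ζ V a s) := by
  obtain ⟨i1, i2, hw⟩ := isWeakGradient_level S hR hRR hΩ hζ hζs a (s := s) (by omega)
  have hBE : Metric.ball x₀ R ⊆ Metric.ball x₀ R₁ := Metric.ball_subset_ball hRR.le
  have hEΩ : Metric.ball x₀ R₁ ⊆ Ω := Metric.ball_subset_closedBall.trans hΩ
  have hBΩ : Metric.ball x₀ R ⊆ Ω := hBE.trans hEΩ
  have zφ : ∀ x, x ∉ Metric.ball x₀ R → levelFun u ζ a s x = 0 := fun x hx => by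
    simp [levelFun, hζz x hx, show s ≠ 0 by omega]
  have zΦ : ∀ x, x ∉ Metric.ball x₀ R → levelGrad u ζ V a s x = 0 := fun x hx => by
    simp [levelGrad, hζz x hx, show s ≠ 0 by omega, show s - 1 ≠ 0 by omega]
  have hE := S.memLoc.2 (Metric.ball x₀ R₁) Metric.isOpen_ball
    ((isCompact_closedBall x₀ R₁).of_isClosed_subset isClosed_closure
      Metric.closure_ball_subset_closedBall) (Metric.closure_ball_subset_closedBall.trans hΩ)
  refine ⟨⟨hw.restrict (fun x hx => zφ x fun h => hx (hBΩ h))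
    (fun x hx => zΦ x fun h => hx (hBΩ h)), i1.integrableOn, i2.integrableOn, ?_⟩,
    Metric.closedBall x₀ R, isCompact_closedBall _ _,
    (Metric.closedBall_subset_closedBall hRR.le).trans hΩ,
    Eventually.of_forall fun x hx => zφ x fun h => hx (Metric.ball_subset_closedBall h)⟩
  have hon : IntegrableOn (fun x => g x ‖levelGrad u ζ V a s x‖ * ‖levelGrad u ζ V a s x‖)
      (Metric.ball x₀ R) volume := by
    have hgm : AEStronglyMeasurable (fun x => g x ‖levelGrad u ζ V a s x‖)
        (volume.restrict (Metric.ball x₀ R)) := by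
      refine aestronglyMeasurable_superposition (f := fun x => ‖levelGrad u ζ V a s x‖)
        (fun v hv => ((S.condG.2.1 v hv).mono_set hBΩ).aestronglyMeasurable) ?_
        i2.aestronglyMeasurable.norm.aemeasurable.restrict (fun x => norm_nonneg _)
      filter_upwards [ae_restrict_of_ae_restrict_of_subset hBΩ S.condG.2.2] with x hx using hx.1
    have hbB : 0 ≤ b₀ := (S.growth x₀ (hBΩ (Metric.mem_ball_self hR))).b₀_nonneg
    have iGV : IntegrableOn (fun x => g x ‖V x‖ * ‖V x‖) (Metric.ball x₀ R) volume :=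
      hE.2.2.2.mono_set hBE
    have iGb : IntegrableOn (fun x => g x (b₀ + 1) * (b₀ + 1)) (Metric.ball x₀ R) volume :=
      ((S.condG.2.1 (b₀ + 1) (by linarith)).mono_set hBΩ).mul_const _
    -- Chosen so that the gradient of the test function is at most N max(|V|, b₀ + 1); doubling then
    -- bounds its energy by that of `V`.
    set N : ℝ := 2 * |m| + m ^ 2 * (s * |D|) + 1 with hN
    have hN1 : 1 ≤ N := by
      have : 0 ≤ 2 * |m| + m ^ 2 * (s * |D|) := by positivity
      linarith
    refine ((iGV.add iGb).const_mul (c₁ * N ^ (q - 1) * N)).mono'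
      (hgm.mul i2.aestronglyMeasurable.norm.restrict) ?_
    filter_upwards [hTm, ae_restrict_mem measurableSet_ball] with x hxm hxB
    have hgr := S.growth x (hBΩ hxB)
    have hgn : 0 ≤ g x ‖levelGrad u ζ V a s x‖ := S.condG.1 x (hBΩ hxB) _ (norm_nonneg _)
    rw [Real.norm_of_nonneg (mul_nonneg hgn (norm_nonneg _))]
    refine hgr.mul_le_of_le_mul_max hN1 (norm_nonneg _) (norm_nonneg _) ?_
    refine (norm_levelGrad_le hζ0 hD x).trans ?_
    have hT : 0 ≤ max (u x - a) 0 := le_max_right _ _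
    have hTm' : max (u x - a) 0 ≤ |m| := hxm.trans (le_abs_self m)
    have hz1 : ζ x ^ s ≤ 1 := pow_le_one₀ (hζ0 x) (hζ1 x)
    have hz2 : ζ x ^ (s - 1) ≤ 1 := pow_le_one₀ (hζ0 x) (hζ1 x)
    have hz0 := hζ0 x
    have hM1 : 1 ≤ max ‖V x‖ (b₀ + 1) := le_trans (by linarith) (le_max_right ‖V x‖ (b₀ + 1))
    have hM2 : ‖V x‖ ≤ max ‖V x‖ (b₀ + 1) := le_max_left _ _
    calc 2 * max (u x - a) 0 * ζ x ^ s * ‖V x‖ + max (u x - a) 0 ^ 2 * (s * ζ x ^ (s - 1) * D)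
        ≤ 2 * |m| * 1 * max ‖V x‖ (b₀ + 1) + |m| ^ 2 * (s * 1 * |D|) * 1 := by
          rw [mul_one (|m| ^ 2 * (s * 1 * |D|))]
          have := le_abs_self D
          have hD0 : 0 ≤ D := (norm_nonneg _).trans (hD x)
          gcongr
      _ ≤ 2 * |m| * 1 * max ‖V x‖ (b₀ + 1) +
          |m| ^ 2 * (s * 1 * |D|) * max ‖V x‖ (b₀ + 1) := by gcongr
      _ ≤ N * max ‖V x‖ (b₀ + 1) := by
          rw [hN, sq_abs]
          nlinarith
  refine ((integrableOn_iff_integrable_of_support_subset ?_).1 hon).integrableOn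
  intro x hx
  by_contra h
  apply hx
  simp [zΦ x h]

theorem SolutionData.integrableOn_closedBall {n : ℕ} {Ω : Set (EuclideanSpace ℝ (Fin n))}
    {g : EuclideanSpace ℝ (Fin n) → ℝ → ℝ} {c₁ q b₀ p : ℝ} {u : EuclideanSpace ℝ (Fin n) → ℝ}
    {V : EuclideanSpace ℝ (Fin n) → EuclideanSpace ℝ (Fin n)} {B : ℝ}
    (S : SolutionData Ω g c₁ q b₀ p u V B) {x₀ : EuclideanSpace ℝ (Fin n)} {R : ℝ}
    (hΩ : Metric.closedBall x₀ R ⊆ Ω) : MemW1G (Metric.ball x₀ R) g u V :=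
  S.memLoc.2 (Metric.ball x₀ R) Metric.isOpen_ball
    ((isCompact_closedBall x₀ R).of_isClosed_subset isClosed_closure
      Metric.closure_ball_subset_closedBall) (Metric.closure_ball_subset_closedBall.trans hΩ)

/-! ### The energy estimate. -/

/-- Caccioppoli inequality, combined with Young's inequality: an `L¹` bound for the gradient of the
weighted superlevel function. -/
theorem integral_norm_levelGrad_le {n : ℕ} {Ω : Set (EuclideanSpace ℝ (Fin n))}
    {g : EuclideanSpace ℝ (Fin n) → ℝ → ℝ} {c₁ q b₀ p : ℝ} {u : EuclideanSpace ℝ (Fin n) → ℝ}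
    {V : EuclideanSpace ℝ (Fin n) → EuclideanSpace ℝ (Fin n)} {B : ℝ}
    (S : SolutionData Ω g c₁ q b₀ p u V B)
    {x₀ : EuclideanSpace ℝ (Fin n)} {R R₁ : ℝ} (hR : 0 < R) (hRR : R < R₁)
    (hΩ : Metric.closedBall x₀ R₁ ⊆ Ω) {ζ : EuclideanSpace ℝ (Fin n) → ℝ}
    (hζ : ContDiff ℝ ∞ ζ) (hζ0 : ∀ x, 0 ≤ ζ x) (hζ1 : ∀ x, ζ x ≤ 1)
    (hζs : tsupport ζ ⊆ Metric.closedBall x₀ R) (hζz : ∀ x, x ∉ Metric.ball x₀ R → ζ x = 0)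
    {a m ρ H A₀ κ : ℝ} (hm : 0 < m) (hρ : 0 < ρ) (hH : 1 ≤ H) (hA₀ : 0 < A₀) (hκ : 1 ≤ κ)
    (hD : ∀ x, ‖gradient ζ x‖ ≤ H / ρ) (hb : b₀ ≤ m / ρ)
    (hTm : ∀ᵐ x ∂(volume.restrict (Metric.ball x₀ R)), max (u x - a) 0 ≤ m)
    (hupper : ∀ x ∈ Metric.ball x₀ R, g x (m / ρ) ≤ κ * A₀)
    (hlower : ∀ x ∈ Metric.ball x₀ R, A₀ ≤ κ * g x (m / ρ)) {s : ℕ} (hs : q ≤ s) :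
    ∫ x, ‖levelGrad u ζ V a s x‖ ≤ (2 * c₁ + 3) * (s * H) ^ s * κ ^ 2 * (m / ρ) *
      ∫ x in Metric.ball x₀ R, max (u x - a) 0 := by
  have hEΩ : Metric.ball x₀ R₁ ⊆ Ω := Metric.ball_subset_closedBall.trans hΩ
  have hBE : Metric.ball x₀ R ⊆ Metric.ball x₀ R₁ := Metric.ball_subset_ball hRR.le
  have hBΩ : Metric.ball x₀ R ⊆ Ω := hBE.trans hEΩ
  have hgr := fun x hx => S.growth x (hBΩ hx)
  have hgr0 := hgr x₀ (Metric.mem_ball_self hR)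
  have hc := hgr0.c₁_pos
  have hsq : (1 : ℝ) < s := lt_of_lt_of_le hgr0.one_lt_q hs
  have hs2 : 2 ≤ s := by exact_mod_cast hsq
  have hmρ : 0 < m / ρ := div_pos hm hρ
  have hκ0 : 0 < κ := by linarith
  obtain ⟨i1, i2, -⟩ := isWeakGradient_level S hR hRR hΩ hζ hζs a (s := s) (by omega)
  have hzero := memW1GZero_level S hR hRR hΩ hζ hζ0 hζ1 hζs hζz hD hTm hs2
  have hE := S.integrableOn_closedBall hΩ
  set T : EuclideanSpace ℝ (Fin n) → ℝ := fun x => max (u x - a) 0 with hTdef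
  set μ := volume.restrict (Metric.ball x₀ R) with hμ
  have hfin : IsFiniteMeasure μ :=
    ⟨by rw [hμ, Measure.restrict_apply_univ]; exact measure_ball_lt_top⟩
  have hT0 : ∀ x, 0 ≤ T x := fun x => le_max_right _ _
  have iu : Integrable u μ := hE.2.1.mono_set hBE
  have iV : Integrable V μ := hE.2.2.1.mono_set hBE
  have iG : Integrable (fun x => g x ‖V x‖ * ‖V x‖) μ := hE.2.2.2.mono_set hBE
  have iT : Integrable T μ := (iu.sub (integrable_const a)).pos_part
  have mζ : AEStronglyMeasurable ζ μ := hζ.continuous.aestronglyMeasurable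
  have mg : AEStronglyMeasurable (fun x => g x ‖V x‖) μ := by
    refine aestronglyMeasurable_superposition (f := fun x => ‖V x‖)
      (fun v hv => ((S.condG.2.1 v hv).mono_set hBΩ).aestronglyMeasurable) ?_
      iV.aestronglyMeasurable.norm.aemeasurable (fun x => norm_nonneg _)
    filter_upwards [ae_restrict_of_ae_restrict_of_subset hBΩ S.condG.2.2] with x hx using hx.1
  have hmem : ∀ᵐ x ∂μ, x ∈ Metric.ball x₀ R := ae_restrict_mem measurableSet_ball
  -- P is the energy density and Q the contribution of ∇ζ; the weak equation reads ∫ (P + Q) = 0.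
  -- With |Q| ≤ P/2 + cT this gives ∫ P ≤ 2c ∫ T.
  set P : EuclideanSpace ℝ (Fin n) → ℝ :=
    fun x => (2 * T x * ζ x ^ s) * (g x ‖V x‖ * ‖V x‖) with hP
  set Q : EuclideanSpace ℝ (Fin n) → ℝ :=
    fun x => g x ‖V x‖ / ‖V x‖ * (T x ^ 2 * (s * ζ x ^ (s - 1)) * inner ℝ (V x) (gradient ζ x))
    with hQ
  set c : ℝ := c₁ * (s * H) ^ s * (κ * A₀) * (m / ρ) with hcdef
  have iP : Integrable P μ := by
    refine iG.bdd_mul (c := 2 * m) ((iT.aestronglyMeasurable.const_mul 2).mul (mζ.pow s)) ?_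
    filter_upwards [hTm] with x hx
    have h1 := hT0 x
    have h2 := hζ0 x
    have h3 : ζ x ^ s ≤ 1 := pow_le_one₀ h2 (hζ1 x)
    rw [Real.norm_of_nonneg (by positivity)]
    calc 2 * T x * ζ x ^ s ≤ 2 * m * 1 := by gcongr
      _ = 2 * m := mul_one _
  have hQle : ∀ᵐ x ∂μ, ‖Q x‖ ≤ 1 / 2 * P x + c * T x := by
    filter_upwards [hTm, hmem] with x hxm hxB
    have h1 := hT0 x
    have h2 := hζ0 x
    have hG0 := S.condG.1 x (hBΩ hxB) ‖V x‖ (norm_nonneg _)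
    rcases (norm_nonneg (V x)).eq_or_lt with hv | hv
    · have hP0 : P x = 0 := by simp [hP, ← hv]
      have hQ0 : Q x = 0 := by simp [hQ, ← hv]
      rw [hP0, hQ0, hcdef]
      simp only [norm_zero, mul_zero, zero_add]
      positivity
    · have hy := (hgr x hxB).young h1 hxm hm hρ h2 (hζ1 x) hH hs hb hv
      have hin : |inner ℝ (V x) (gradient ζ x)| ≤ ‖V x‖ * (H / ρ) :=
        (abs_real_inner_le_norm _ _).trans (mul_le_mul_of_nonneg_left (hD x) hv.le)
      have e1 : ‖Q x‖ ≤ g x ‖V x‖ * T x ^ 2 * (s * ζ x ^ (s - 1) * (H / ρ)) := by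
        rw [hQ, Real.norm_eq_abs, abs_mul, abs_mul, abs_of_nonneg (by positivity),
          abs_of_nonneg (by positivity)]
        calc _ ≤ g x ‖V x‖ / ‖V x‖ * (T x ^ 2 * (s * ζ x ^ (s - 1)) * (‖V x‖ * (H / ρ))) := by
              gcongr
          _ = _ := by field_simp
      have e2 : c₁ * (s * H) ^ s * g x (m / ρ) * (m / ρ) * T x ≤ c * T x := by
        rw [hcdef]
        have := hupper x hxB
        gcongr
      refine e1.trans (hy.trans ?_)
      rw [hP]
      linarith
  have iQ : Integrable Q μ := by
    refine ((iP.const_mul (1 / 2)).add (iT.const_mul c)).mono' ?_ hQle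
    exact (mg.mul iV.aestronglyMeasurable.norm.aemeasurable.inv.aestronglyMeasurable).mul
      (((iT.aestronglyMeasurable.pow 2).mul ((mζ.pow (s - 1)).const_mul (s : ℝ))).mul
        (iV.aestronglyMeasurable.inner (continuous_gradient hζ).aestronglyMeasurable))
  have hPQ : ∀ x, inner ℝ ((g x ‖V x‖ / ‖V x‖) • V x) (levelGrad u ζ V a s x) = P x + Q x := by
    intro x
    rw [levelGrad, inner_smul_left, inner_add_right, inner_smul_right, inner_smul_right,
      inner_smul_right, real_inner_self_eq_norm_sq]
    simp only [hP, hQ, hTdef, conj_trivial]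
    rcases eq_or_ne ‖V x‖ 0 with hv | hv
    · simp [hv]
    · field_simp
  have heq : ∫ x, P x + Q x ∂μ = 0 := by
    rw [← S.weak_eq _ _ hzero]
    simp_rw [hPQ]
    refine (setIntegral_eq_of_subset_of_forall_sdiff_eq_zero S.isOpen.measurableSet hBΩ
      fun x hx => ?_).symm
    rw [← hPQ]
    simp [levelGrad, hζz x hx.2, show s ≠ 0 by omega, show s - 1 ≠ 0 by omega]
  rw [integral_add iP iQ] at heq
  have hPle : ∫ x, P x ∂μ ≤ 2 * c * ∫ x, T x ∂μ := by
    have h1 : -∫ x, Q x ∂μ ≤ 1 / 2 * ∫ x, P x ∂μ + c * ∫ x, T x ∂μ := by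
      rw [← integral_neg, ← integral_const_mul, ← integral_const_mul,
        ← integral_add (iP.const_mul _) (iT.const_mul _)]
      refine integral_mono_ae iQ.neg ((iP.const_mul _).add (iT.const_mul _)) ?_
      filter_upwards [hQle] with x hx
      exact (neg_le_abs _).trans hx
    linarith
  have hΦle : ∀ᵐ x ∂μ, ‖levelGrad u ζ V a s x‖ ≤
      κ / A₀ * P x + (2 + s * H) * (m / ρ) * T x := by
    filter_upwards [hTm, hmem] with x hxm hxB
    have h1 := hT0 x
    have h2 := hζ0 x
    have hz1 : ζ x ^ s ≤ 1 := pow_le_one₀ h2 (hζ1 x)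
    have hz2 : ζ x ^ (s - 1) ≤ 1 := pow_le_one₀ h2 (hζ1 x)
    have hG0 := S.condG.1 x (hBΩ hxB) ‖V x‖ (norm_nonneg _)
    have e1 := (hgr x hxB).gradient_le h1 (pow_nonneg h2 s) hz1 hmρ hA₀ (hlower x hxB)
      (norm_nonneg (V x)) hκ0 hG0
    have e2 : T x ^ 2 * (s * ζ x ^ (s - 1) * (H / ρ)) ≤ s * H * (m / ρ) * T x := by
      calc _ ≤ (T x * m) * (s * 1 * (H / ρ)) := by
            rw [sq]
            gcongr
        _ = _ := by ring
    refine (norm_levelGrad_le hζ0 hD x).trans ((add_le_add e1 e2).trans (le_of_eq ?_))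
    rw [hP]
    ring
  have hint : ∫ x, ‖levelGrad u ζ V a s x‖ = ∫ x, ‖levelGrad u ζ V a s x‖ ∂μ := by
    refine (setIntegral_eq_integral_of_forall_compl_eq_zero fun x hx => ?_).symm
    simp [levelGrad, hζz x hx, show s ≠ 0 by omega, show s - 1 ≠ 0 by omega]
  have hIT : 0 ≤ ∫ x, T x ∂μ := integral_nonneg hT0
  have hsH : 1 ≤ s * H := by nlinarith
  have hsHs : s * H ≤ (s * H) ^ s := le_self_pow₀ hsH (by omega)
  rw [hint]
  calc ∫ x, ‖levelGrad u ζ V a s x‖ ∂μ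
      ≤ ∫ x, κ / A₀ * P x + (2 + s * H) * (m / ρ) * T x ∂μ :=
        integral_mono_ae i2.norm.restrict ((iP.const_mul _).add (iT.const_mul _)) hΦle
    _ = κ / A₀ * ∫ x, P x ∂μ + (2 + s * H) * (m / ρ) * ∫ x, T x ∂μ := by
        rw [integral_add (iP.const_mul _) (iT.const_mul _), integral_const_mul,
          integral_const_mul]
    _ ≤ κ / A₀ * (2 * c * ∫ x, T x ∂μ) + (2 + s * H) * (m / ρ) * ∫ x, T x ∂μ := by gcongr
    -- `c` contains the factor κ A₀, so against κ/A₀ the frozen value cancels and κ² is left.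
    _ = (2 * c₁ * (s * H) ^ s * κ ^ 2 + (2 + s * H)) * ((m / ρ) * ∫ x, T x ∂μ) := by
        rw [hcdef]
        field_simp
    _ ≤ ((2 * c₁ + 3) * (s * H) ^ s * κ ^ 2) * ((m / ρ) * ∫ x, T x ∂μ) := by
        gcongr
        have h1 : 1 ≤ κ ^ 2 := one_le_pow₀ hκ
        have h2 : (s * H) ^ s * 1 ≤ (s * H) ^ s * κ ^ 2 := by gcongr
        nlinarith
    _ = _ := by ring

/-! ### De Giorgi's iteration. -/

/-- Fast geometric convergence, with natural exponents. -/
theorem le_of_fast_geometric {ν : ℕ} (hν : ν ≠ 0) {Y : ℕ → ℝ} {b K : ℝ} (hY : ∀ j, 0 ≤ Y j)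
    (hb : 0 < b) (hK : 0 < K) (hstep : ∀ j, Y (j + 1) ^ ν ≤ (K * b ^ j * Y j) ^ (ν + 1))
    (h0 : Y 0 ≤ (b ^ ((ν + 1) * ν) * K ^ (ν + 1))⁻¹) (j : ℕ) :
    Y j ≤ (b ^ ((ν + 1) * (j + ν)) * K ^ (ν + 1))⁻¹ := by
  induction j with
  | zero => simpa using h0
  | succ j ih =>
    refine le_of_pow_le_pow_left₀ hν (by positivity) ((hstep j).trans ?_)
    -- The exponents match, (ν + 1)(j + ν) = j + (j + 1 + ν)ν, so the bound for index j reproduces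
    -- itself exactly at j + 1.
    have h1 : K * b ^ j * Y j ≤ ((b ^ (j + 1 + ν) * K)⁻¹) ^ ν := by
      refine (mul_le_mul_of_nonneg_left ih (by positivity)).trans (le_of_eq ?_)
      rw [show (ν + 1) * (j + ν) = j + (j + 1 + ν) * ν by ring, pow_add, pow_mul, inv_pow, mul_pow,
        pow_succ K]
      field_simp
    calc (K * b ^ j * Y j) ^ (ν + 1) ≤ (((b ^ (j + 1 + ν) * K)⁻¹) ^ ν) ^ (ν + 1) := by
          have := hY j
          gcongr
      _ = ((b ^ ((ν + 1) * (j + 1 + ν)) * K ^ (ν + 1))⁻¹) ^ ν := by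
          rw [← pow_mul, mul_comm ν, pow_mul]
          congr 1
          rw [inv_pow, mul_pow, ← pow_mul, mul_comm (j + 1 + ν)]

theorem tendsto_zero_of_fast_geometric {ν : ℕ} (hν : ν ≠ 0) {Y : ℕ → ℝ} {b K : ℝ}
    (hY : ∀ j, 0 ≤ Y j) (hb : 1 < b) (hK : 0 < K)
    (hstep : ∀ j, Y (j + 1) ^ ν ≤ (K * b ^ j * Y j) ^ (ν + 1))
    (h0 : Y 0 ≤ (b ^ ((ν + 1) * ν) * K ^ (ν + 1))⁻¹) : Tendsto Y atTop (𝓝 0) := by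
  have hb0 : 0 < b := by linarith
  have hlim : Tendsto (fun j : ℕ => ((b ^ (ν + 1))⁻¹) ^ j * (b ^ ((ν + 1) * ν) * K ^ (ν + 1))⁻¹)
      atTop (𝓝 0) := by
    have := (tendsto_pow_atTop_nhds_zero_of_lt_one (r := (b ^ (ν + 1))⁻¹) (by positivity)
      (inv_lt_one_of_one_lt₀ (one_lt_pow₀ hb (by omega)))).mul_const
      (b ^ ((ν + 1) * ν) * K ^ (ν + 1))⁻¹
    simpa using this
  refine squeeze_zero hY (fun j => ?_) hlim
  refine (le_of_fast_geometric hν hY hb0 hK hstep h0 j).trans (le_of_eq ?_)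
  rw [inv_pow, ← mul_inv, ← pow_mul]
  congr 1
  ring

/-- One step of De Giorgi's iteration. -/
theorem superlevel_step {ν : ℕ} (hν : 1 ≤ ν) {Ω : Set (EuclideanSpace ℝ (Fin (ν + 1)))}
    {g : EuclideanSpace ℝ (Fin (ν + 1)) → ℝ → ℝ} {c₁ q b₀ p : ℝ}
    {u : EuclideanSpace ℝ (Fin (ν + 1)) → ℝ}
    {V : EuclideanSpace ℝ (Fin (ν + 1)) → EuclideanSpace ℝ (Fin (ν + 1))} {B : ℝ}
    (S : SolutionData Ω g c₁ q b₀ p u V B)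
    {x₀ : EuclideanSpace ℝ (Fin (ν + 1))} {r R R₁ : ℝ} (hr : 0 < r) (hrR : r < R) (hRR : R < R₁)
    (hΩ : Metric.closedBall x₀ R₁ ⊆ Ω) {L : ℝ} (hL1 : 1 ≤ L)
    (hL : ∃ ζ : EuclideanSpace ℝ (Fin (ν + 1)) → ℝ, ContDiff ℝ ∞ ζ ∧
      (∀ x, 0 ≤ ζ x) ∧ (∀ x, ζ x ≤ 1) ∧ (∀ x ∈ Metric.closedBall x₀ r, ζ x = 1) ∧
      tsupport ζ ⊆ Metric.closedBall x₀ R ∧ (∀ x, x ∉ Metric.ball x₀ R → ζ x = 0) ∧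
      ∀ x, ‖gradient ζ x‖ ≤ L / (R - r))
    {a h m ρ A₀ κ : ℝ} (hh : 0 < h) (hm : 0 < m) (hρ : 0 < ρ) (hRρ : R - r ≤ ρ)
    (hA₀ : 0 < A₀) (hκ : 1 ≤ κ) (hb : b₀ ≤ m / ρ)
    (hTm : ∀ᵐ x ∂(volume.restrict (Metric.ball x₀ R)), u x - a ≤ m)
    (hupper : ∀ x ∈ Metric.ball x₀ R, g x (m / ρ) ≤ κ * A₀)
    (hlower : ∀ x ∈ Metric.ball x₀ R, A₀ ≤ κ * g x (m / ρ)) {s : ℕ} (hs : q ≤ s) :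
    (h ^ 2) ^ (ν + 1) * volume.real (Metric.ball x₀ r ∩ {x | a + h < u x}) ^ ν ≤
      (lintegralPowLePowLIntegralFDerivConst
        (volume : Measure (EuclideanSpace ℝ (Fin (ν + 1)))) (((ν : ℝ) + 1) / ν) : ℝ) ^ ν *
      ((2 * c₁ + 3) * (s * (L * (ρ / (R - r)))) ^ s * κ ^ 2 * (m ^ 2 / ρ) *
        volume.real (Metric.ball x₀ R ∩ {x | a < u x})) ^ (ν + 1) := by
  have hν0 : (0 : ℝ) < ν := by exact_mod_cast hν
  have hR : 0 < R := hr.trans hrR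
  have hd : 0 < R - r := by linarith
  obtain ⟨ζ, hζ, hζ0, hζ1, hζr, hζs, hζz, hD⟩ := hL
  -- The Sobolev exponent n/(n - 1) for n = ν + 1; raising the inequality to the power ν later
  -- clears the fraction.
  set p' : ℝ := ((ν : ℝ) + 1) / ν with hp'
  have hp'0 : 0 < p' := by positivity
  have hconj : Real.HolderConjugate ((ν + 1 : ℕ) : ℝ) p' := by
    rw [Real.holderConjugate_iff, hp']
    push_cast
    refine ⟨by linarith, ?_⟩
    field_simp
    ring
  have hBΩ : Metric.ball x₀ R ⊆ Ω :=
    (Metric.ball_subset_ball hRR.le).trans (Metric.ball_subset_closedBall.trans hΩ)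
  have hgr0 := S.growth x₀ (hBΩ (Metric.mem_ball_self hR))
  have hc := hgr0.c₁_pos
  have hsq : (1 : ℝ) < s := lt_of_lt_of_le hgr0.one_lt_q hs
  have hs2 : 2 ≤ s := by exact_mod_cast hsq
  have hH : 1 ≤ L * (ρ / (R - r)) := by
    have : 1 ≤ ρ / (R - r) := (one_le_div hd).2 hRρ
    nlinarith
  have hTm' : ∀ᵐ x ∂(volume.restrict (Metric.ball x₀ R)), max (u x - a) 0 ≤ m := by
    filter_upwards [hTm] with x hx using max_le hx hm.le
  have hen := integral_norm_levelGrad_le S hR hRR hΩ hζ hζ0 hζ1 hζs hζz hm hρ hH hA₀ hκ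
    (fun x => (hD x).trans (le_of_eq (by field_simp))) hb hTm' hupper hlower hs
  obtain ⟨i1, i2, hw⟩ := isWeakGradient_level S hR hRR hΩ hζ hζs a (s := s) (by omega)
  have hcs : HasCompactSupport (levelFun u ζ a s) := by
    refine HasCompactSupport.of_support_subset_isCompact (isCompact_closedBall x₀ R) fun x hx => ?_
    by_contra hxB
    apply hx
    simp [levelFun, hζz x fun h' => hxB (Metric.ball_subset_closedBall h'), show s ≠ 0 by omega]
  have hsob := lintegral_rpow_le_of_isWeakGradient hconj i1 i2 hw hcs
  set C := lintegralPowLePowLIntegralFDerivConst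
    (volume : Measure (EuclideanSpace ℝ (Fin (ν + 1)))) p' with hC
  set A' := Metric.ball x₀ r ∩ {x | a + h < u x} with hA'
  set A := Metric.ball x₀ R ∩ {x | a < u x} with hA
  set I := ∫ x, ‖levelGrad u ζ V a s x‖ with hI
  have hI0 : 0 ≤ I := integral_nonneg fun x => norm_nonneg _
  have hAfin : volume A ≠ ⊤ :=
    ((measure_mono inter_subset_left).trans_lt measure_ball_lt_top).ne
  have hA'fin : volume A' ≠ ⊤ :=
    ((measure_mono inter_subset_left).trans_lt measure_ball_lt_top).ne
  -- Chebyshev's inequality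
  have hcheb : ENNReal.ofReal (h ^ 2) ^ p' * volume A' ≤ ∫⁻ x, ‖levelFun u ζ a s x‖ₑ ^ p' := by
    have hm1 : AEMeasurable (fun x => ‖levelFun u ζ a s x‖ₑ ^ p') volume :=
      i1.aestronglyMeasurable.enorm.pow_const p'
    refine le_trans ?_ (mul_meas_ge_le_lintegral₀ hm1 (ENNReal.ofReal (h ^ 2) ^ p'))
    gcongr
    intro x hx
    show ENNReal.ofReal (h ^ 2) ^ p' ≤ ‖levelFun u ζ a s x‖ₑ ^ p'
    gcongr
    rw [← ofReal_norm]
    refine ENNReal.ofReal_le_ofReal ?_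
    have hx2 : a + h < u x := hx.2
    have h1 : h ≤ max (u x - a) 0 := le_trans (by linarith) (le_max_left _ _)
    rw [levelFun, hζr x (Metric.ball_subset_closedBall hx.1), one_pow, mul_one,
      Real.norm_of_nonneg (by positivity)]
    gcongr
  have hreal : (h ^ 2) ^ p' * volume.real A' ≤ C * I ^ p' := by
    have h1 := hcheb.trans hsob
    rw [← ofReal_integral_norm_eq_lintegral_enorm i2, ← hI,
      ENNReal.ofReal_rpow_of_nonneg (by positivity) hp'0.le,
      ENNReal.ofReal_rpow_of_nonneg hI0 hp'0.le, ← ENNReal.ofReal_coe_nnreal,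
      ← ENNReal.ofReal_mul (by positivity), ← ENNReal.ofReal_toReal hA'fin,
      ← ENNReal.ofReal_mul (by positivity)] at h1
    exact (ENNReal.ofReal_le_ofReal_iff (by positivity)).1 h1
  have hpow : ∀ y : ℝ, 0 ≤ y → (y ^ p') ^ ν = y ^ (ν + 1) := by
    intro y hy
    rw [← Real.rpow_natCast (y ^ p') ν, ← Real.rpow_mul hy, ← Real.rpow_natCast y (ν + 1), hp',
      div_mul_cancel₀ _ hν0.ne']
    push_cast
    rfl
  have hfinal : (h ^ 2) ^ (ν + 1) * volume.real A' ^ ν ≤ (C : ℝ) ^ ν * I ^ (ν + 1) := by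
    rw [← hpow _ (by positivity), ← hpow I hI0, ← mul_pow, ← mul_pow]
    exact pow_le_pow_left₀ (by positivity) hreal ν
  refine hfinal.trans ?_
  -- The truncation is at most m and vanishes off the superlevel set.
  have hIT : ∫ x in Metric.ball x₀ R, max (u x - a) 0 ≤ m * volume.real A := by
    have hE := S.integrableOn_closedBall hΩ
    have hBE : Metric.ball x₀ R ⊆ Metric.ball x₀ R₁ := Metric.ball_subset_ball hRR.le
    have iu : IntegrableOn u (Metric.ball x₀ R) volume := hE.2.1.mono_set hBE
    have hAm : NullMeasurableSet {x | a < u x} (volume.restrict (Metric.ball x₀ R)) :=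
      nullMeasurableSet_lt aemeasurable_const iu.aestronglyMeasurable.aemeasurable
    have e1 : volume.real A = (volume.restrict (Metric.ball x₀ R)).real {x | a < u x} := by
      rw [measureReal_def, measureReal_def, Measure.restrict_apply₀ hAm, hA, inter_comm]
    have hfin : IsFiniteMeasure (volume.restrict (Metric.ball x₀ R)) :=
      ⟨by rw [Measure.restrict_apply_univ]; exact measure_ball_lt_top⟩
    rw [e1, mul_comm, ← smul_eq_mul, ← setIntegral_const, ← integral_indicator₀ hAm]
    refine integral_mono_of_nonneg (Eventually.of_forall fun x => le_max_right _ _)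
      ((integrable_const m).indicator₀ hAm) ?_
    filter_upwards [hTm'] with x hx
    by_cases hxa : a < u x
    · rw [indicator_of_mem (show x ∈ {x | a < u x} from hxa)]
      exact hx
    · rw [indicator_of_notMem (show x ∉ {x | a < u x} from hxa)]
      exact max_le (by linarith) le_rfl
  gcongr
  refine hen.trans ?_
  calc _ ≤ (2 * c₁ + 3) * (s * (L * (ρ / (R - r)))) ^ s * κ ^ 2 * (m / ρ) *
        (m * volume.real A) := by gcongr
    _ = _ := by ring

/-- De Giorgi's lemma: if `u + k` exceeds a quarter of its supremum `m` over a ball only on a set of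
small measure, then `u + k ≤ m / 2` on the smaller ball. -/
theorem exists_deGiorgi {ν : ℕ} (hν : 1 ≤ ν) {c₁ : ℝ} (hc₁ : 0 < c₁) (s : ℕ) (hs0 : s ≠ 0) :
    ∃ ε : ℝ, 0 < ε ∧ ∀ (Ω : Set (EuclideanSpace ℝ (Fin (ν + 1))))
    (g : EuclideanSpace ℝ (Fin (ν + 1)) → ℝ → ℝ) (q b₀ p : ℝ)
    (u : EuclideanSpace ℝ (Fin (ν + 1)) → ℝ)
    (V : EuclideanSpace ℝ (Fin (ν + 1)) → EuclideanSpace ℝ (Fin (ν + 1))) (B : ℝ),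
    SolutionData Ω g c₁ q b₀ p u V B → q ≤ s →
    ∀ (x₀ : EuclideanSpace ℝ (Fin (ν + 1))) (r R R₁ : ℝ), 0 < r → r < R → R < R₁ →
    Metric.closedBall x₀ R₁ ⊆ Ω → ∀ (m ρ A₀ κ k : ℝ), 0 < m → 0 < ρ → R - r ≤ ρ → 0 < A₀ →
    1 ≤ κ → b₀ ≤ m / ρ →
    (∀ᵐ x ∂(volume.restrict (Metric.ball x₀ R)), u x + k ≤ m) →
    (∀ x ∈ Metric.ball x₀ R, g x (m / ρ) ≤ κ * A₀) →
    (∀ x ∈ Metric.ball x₀ R, A₀ ≤ κ * g x (m / ρ)) →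
    volume.real (Metric.ball x₀ R ∩ {x | m / 4 < u x + k}) ≤
      ε * (((R - r) / ρ) ^ s) ^ (ν + 1) * ρ ^ (ν + 1) / (κ ^ 2) ^ (ν + 1) →
    ∀ᵐ x ∂(volume.restrict (Metric.ball x₀ r)), u x + k ≤ m / 2 := by
  obtain ⟨L, hL1, hL⟩ := exists_cutoff
  -- The maximum with 1 allows C^ν to be replaced by C^(ν+1), so that all constants stand under one
  -- power.
  set C : ℝ := max (lintegralPowLePowLIntegralFDerivConst
    (volume : Measure (EuclideanSpace ℝ (Fin (ν + 1)))) (((ν : ℝ) + 1) / ν) : ℝ) 1 with hC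
  have hC1 : 1 ≤ C := le_max_right _ _
  -- 64 comes from the level gaps 2^(-j) m/8, squared; (2sL)^s comes from the radial gaps 2^(-j)(R -
  -- r)/2.
  set K₀ : ℝ := C * (64 * (2 * c₁ + 3) * (2 * s * L) ^ s) with hK₀
  have hs1 : (0 : ℝ) < s := by exact_mod_cast Nat.pos_of_ne_zero hs0
  have hL0 : 0 < L := by linarith
  have hK₀0 : 0 < K₀ := by positivity
  -- Per step, halving the radial gap costs 2^s and halving the level gap costs 4.
  set b : ℝ := 2 ^ (s + 2) with hb
  have hb1 : 1 < b := one_lt_pow₀ one_lt_two (by omega)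
  have hb0 : 0 < b := by linarith
  refine ⟨(b ^ ((ν + 1) * ν) * K₀ ^ (ν + 1))⁻¹, by positivity, ?_⟩
  intro Ω g q b₀ p u V B S hs x₀ r R R₁ hr hrR hRR hΩ m ρ A₀ κ k hm hρ hRρ hA₀ hκ hbm hum hup hlo
    hsmall
  have hd : 0 < R - r := by linarith
  set K : ℝ := K₀ * (ρ / (R - r)) ^ s * κ ^ 2 / ρ with hK
  have hK0 : 0 < K := by positivity
  -- Radii decrease from R to r while the levels for u + k rise from m/4 to m/2.
  set Rj : ℕ → ℝ := fun j => r + (1 / 2) ^ j * (R - r) with hRj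
  set aj : ℕ → ℝ := fun j => m / 2 - (1 / 2) ^ j * (m / 4) - k with haj
  set Y : ℕ → ℝ := fun j => volume.real (Metric.ball x₀ (Rj j) ∩ {x | aj j < u x}) with hY
  have ht : ∀ j : ℕ, (0 : ℝ) < (1 / 2) ^ j := fun j => by positivity
  have ht1 : ∀ j : ℕ, ((1 : ℝ) / 2) ^ j ≤ 1 := fun j => pow_le_one₀ (by norm_num) (by norm_num)
  have hts : ∀ j : ℕ, ((1 : ℝ) / 2) ^ (j + 1) = (1 / 2) ^ j / 2 := fun j => by ring
  have hstep : ∀ j, Y (j + 1) ^ ν ≤ (K * b ^ j * Y j) ^ (ν + 1) := by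
    intro j
    have hRjpos : 0 < Rj (j + 1) := by
      have := ht (j + 1)
      simp only [hRj]
      positivity
    have hRjsub : Rj j - Rj (j + 1) = (1 / 2) ^ j * (R - r) / 2 := by
      simp only [hRj, hts]
      ring
    have hRjlt : Rj (j + 1) < Rj j := by
      have : 0 < (1 / 2 : ℝ) ^ j * (R - r) / 2 := by positivity
      linarith
    have hRjR : Rj j ≤ R := by
      have := mul_le_mul_of_nonneg_right (ht1 j) hd.le
      simp only [hRj]
      linarith
    have hball : Metric.ball x₀ (Rj j) ⊆ Metric.ball x₀ R := Metric.ball_subset_ball hRjR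
    have h := superlevel_step hν S hRjpos hRjlt (hRjR.trans_lt hRR) hΩ hL1
      (hL (ν + 1) x₀ (Rj (j + 1)) (Rj j) hRjpos hRjlt) (a := aj j)
      (h := (1 / 2) ^ j * (m / 8)) (by positivity) hm hρ
      (by rw [hRjsub]; nlinarith [ht1 j]) hA₀ hκ hbm
      (by
        filter_upwards [ae_restrict_of_ae_restrict_of_subset hball hum] with x hx
        simp only [haj]
        nlinarith [ht1 j])
      (fun x hx => hup x (hball hx)) (fun x hx => hlo x (hball hx)) hs
    have hset : aj j + (1 / 2) ^ j * (m / 8) = aj (j + 1) := by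
      simp only [haj, hts]
      ring
    rw [hset, hRjsub] at h
    set h' : ℝ := (1 / 2) ^ j * (m / 8) with hh'
    have hh'0 : 0 < h' := by positivity
    have hYj : 0 ≤ Y j := measureReal_nonneg
    have hYj1 : 0 ≤ Y (j + 1) := measureReal_nonneg
    have h2 : (h' ^ 2) ^ (ν + 1) * Y (j + 1) ^ ν ≤
        (h' ^ 2) ^ (ν + 1) * (K * b ^ j * Y j) ^ (ν + 1) := by
      refine h.trans ?_
      have e1 : (lintegralPowLePowLIntegralFDerivConst
          (volume : Measure (EuclideanSpace ℝ (Fin (ν + 1)))) (((ν : ℝ) + 1) / ν) : ℝ) ^ ν ≤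
          C ^ (ν + 1) :=
        (pow_le_pow_left₀ (NNReal.coe_nonneg _) (le_max_left _ _) ν).trans
          (pow_le_pow_right₀ hC1 (by omega))
      refine (mul_le_mul_of_nonneg_right e1 (by positivity)).trans (le_of_eq ?_)
      rw [← mul_pow, ← mul_pow]
      congr 1
      have e2 : b ^ j * ((1 / 2 : ℝ) ^ j) ^ 2 * ((1 / 2 : ℝ) ^ j) ^ s = 1 := by
        rw [mul_assoc, ← pow_add, add_comm 2 s, hb, ← pow_mul, ← pow_mul, mul_comm (s + 2) j,
          ← mul_pow]
        norm_num
      have e3 : (s * (L * (ρ / ((1 / 2) ^ j * (R - r) / 2)))) ^ s * ((1 / 2 : ℝ) ^ j) ^ s =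
          (2 * s * L) ^ s * (ρ / (R - r)) ^ s := by
        rw [← mul_pow, ← mul_pow]
        congr 1
        have := (ht j).ne'
        field_simp
      have ht0 : ((1 / 2 : ℝ) ^ j) ^ s ≠ 0 := by positivity
      refine mul_right_cancel₀ ht0 ?_
      calc _ = C * ((2 * c₁ + 3) * ((s * (L * (ρ / ((1 / 2) ^ j * (R - r) / 2)))) ^ s *
            ((1 / 2 : ℝ) ^ j) ^ s) * κ ^ 2 * (m ^ 2 / ρ) * Y j) := by ring
        _ = C * ((2 * c₁ + 3) * ((2 * s * L) ^ s * (ρ / (R - r)) ^ s) * κ ^ 2 * (m ^ 2 / ρ) *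
            Y j) * (b ^ j * ((1 / 2 : ℝ) ^ j) ^ 2 * ((1 / 2 : ℝ) ^ j) ^ s) := by
          rw [e3, e2, mul_one]
        _ = _ := by
          rw [hh', hK, hK₀]
          ring
    exact le_of_mul_le_mul_left h2 (by positivity)
  have hY0 : Y 0 ≤ (b ^ ((ν + 1) * ν) * K ^ (ν + 1))⁻¹ := by
    have e0 : Y 0 = volume.real (Metric.ball x₀ R ∩ {x | m / 4 < u x + k}) := by
      simp only [hY, hRj, haj, pow_zero, one_mul]
      congr 2
      · congr 1
        ring
      · ext x
        show m / 2 - m / 4 - k < u x ↔ m / 4 < u x + k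
        constructor <;> intro h <;> linarith
    rw [e0]
    refine hsmall.trans (le_of_eq ?_)
    rw [hK]
    clear_value K₀ b
    generalize R - r = d at hd
    simp only [div_pow, mul_pow]
    field_simp
  have hlim := tendsto_zero_of_fast_geometric (Y := Y) (by omega) (fun j => measureReal_nonneg) hb1 hK0
    hstep hY0
  have hzero : volume.real (Metric.ball x₀ r ∩ {x | m / 2 < u x + k}) = 0 := by
    refine le_antisymm (ge_of_tendsto' hlim fun j => ?_) measureReal_nonneg
    refine measureReal_mono ?_
      ((measure_mono inter_subset_left).trans_lt measure_ball_lt_top).ne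
    refine inter_subset_inter (Metric.ball_subset_ball ?_) fun x hx => ?_
    · have : 0 < (1 / 2 : ℝ) ^ j * (R - r) := by positivity
      simp only [hRj]
      linarith
    · have hx' : m / 2 < u x + k := hx
      have : 0 < (1 / 2 : ℝ) ^ j * (m / 4) := by positivity
      show aj j < u x
      simp only [haj]
      linarith
  rw [measureReal_eq_zero_iff
    ((measure_mono inter_subset_left).trans_lt measure_ball_lt_top).ne] at hzero
  rw [ae_restrict_iff' measurableSet_ball, ae_iff]
  convert hzero using 2
  ext x
  simp

/-! ### The doubling argument. -/

/-- For real functions `essSup` is meaningful only with bounds on both sides and a nonzero measure;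
otherwise it may be a default value. -/
theorem essSup_bounds {α : Type*} [MeasurableSpace α] {μ : Measure α} (hμ : μ ≠ 0) {u : α → ℝ}
    {M : ℝ} (h0 : ∀ᵐ x ∂μ, 0 ≤ u x) (hM : ∀ᵐ x ∂μ, u x ≤ M) :
    (∀ᵐ x ∂μ, u x ≤ essSup u μ) ∧ 0 ≤ essSup u μ ∧ essSup u μ ≤ M ∧
      ∀ c, (∀ᵐ x ∂μ, u x ≤ c) → essSup u μ ≤ c := by
  have hne : (ae μ).NeBot := ae_neBot.2 hμ
  have hbdd : IsBoundedUnder (· ≤ ·) (ae μ) u := ⟨M, hM⟩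
  have hcob : IsCoboundedUnder (· ≤ ·) (ae μ) u :=
    IsBoundedUnder.isCoboundedUnder_flip (r := (· ≥ ·)) ⟨0, h0⟩
  have h1 := ae_le_essSup hbdd
  have h2 : ∀ c, (∀ᵐ x ∂μ, u x ≤ c) → essSup u μ ≤ c := fun c hc =>
    essSup_le_of_ae_le c hc hcob
  refine ⟨h1, ?_, h2 M hM, h2⟩
  obtain ⟨x, hx0, hx1⟩ := (h0.and h1).exists
  exact hx0.trans hx1

theorem volume_real_ball {n : ℕ} (x : EuclideanSpace ℝ (Fin n)) {R : ℝ} (hR : 0 < R) :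
    volume.real (Metric.ball x R) =
      R ^ n * volume.real (Metric.ball (0 : EuclideanSpace ℝ (Fin n)) 1) := by
  rw [measureReal_def, Measure.addHaar_ball_of_pos volume x hR, ENNReal.toReal_mul,
    ENNReal.toReal_ofReal (by positivity), measureReal_def]
  simp

theorem volume_restrict_ball_ne_zero {n : ℕ} (x : EuclideanSpace ℝ (Fin n)) {R : ℝ} (hR : 0 < R) :
    volume.restrict (Metric.ball x R) ≠ 0 := by
  rw [Ne, Measure.restrict_eq_zero]
  exact (Metric.measure_ball_pos volume x hR).ne'

/-- Continuity of g(x₀, ·) is not available at a prescribed point, so measurability comes from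
monotonicity, after truncating the argument below at a positive value. -/
theorem Growth.integrable_comp {α : Type*} [MeasurableSpace α] {μ : Measure α} [IsFiniteMeasure μ]
    {c₁ q b₀ p : ℝ} {G : ℝ → ℝ} (h : Growth c₁ q b₀ p G) {w : α → ℝ} (hw : AEMeasurable w μ)
    {a b : ℝ} (ha : 0 < a) (hwa : ∀ᵐ x ∂μ, a ≤ w x) (hwb : ∀ᵐ x ∂μ, w x ≤ b) :
    Integrable (fun x => G (w x)) μ := by
  have hm : Monotone fun v => G (max v a) := fun v w hvw =>
    h.mono _ _ (lt_of_lt_of_le ha (le_max_right _ _)) (max_le_max_right _ hvw)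
  have hmeas : AEStronglyMeasurable (fun x => G (w x)) μ := by
    refine (hm.measurable.comp_aemeasurable hw).aestronglyMeasurable.congr ?_
    filter_upwards [hwa] with x hx
    simp [max_eq_left hx]
  refine Integrable.of_bound hmeas (G b) ?_
  filter_upwards [hwa, hwb] with x hxa hxb
  rw [Real.norm_of_nonneg (h.pos _ (ha.trans_le hxa)).le]
  exact h.mono _ _ (ha.trans_le hxa) hxb

/-- The sub-estimate under a direct comparison of `g(x, ·)` with `g(x₀, ·)`. -/
theorem exists_subestimate {ν : ℕ} (hν : 1 ≤ ν) {c₁ q p : ℝ} (hc₁ : 0 < c₁) (hq : 1 < q)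
    (hp : 1 < p) :
    ∃ Γ : ℝ, 0 < Γ ∧ ∀ (Ω : Set (EuclideanSpace ℝ (Fin (ν + 1))))
    (g : EuclideanSpace ℝ (Fin (ν + 1)) → ℝ → ℝ) (b₀ : ℝ)
    (u : EuclideanSpace ℝ (Fin (ν + 1)) → ℝ)
    (V : EuclideanSpace ℝ (Fin (ν + 1)) → EuclideanSpace ℝ (Fin (ν + 1))) (B : ℝ),
    SolutionData Ω g c₁ q b₀ p u V B →
    ∀ (x₀ : EuclideanSpace ℝ (Fin (ν + 1))) (ρ M k κ : ℝ), 0 < ρ → 0 < k → b₀ * ρ ≤ k → 1 ≤ κ →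
    Metric.closedBall x₀ (2 * ρ) ⊆ Ω →
    (∀ᵐ x ∂(volume.restrict Ω), 0 ≤ u x) → (∀ᵐ x ∂(volume.restrict Ω), u x ≤ M) →
    (∀ x ∈ Metric.ball x₀ (5 / 4 * ρ), ∀ m, k ≤ m → m ≤ M + k →
      g x (m / ρ) ≤ κ * g x₀ (m / ρ) ∧ g x₀ (m / ρ) ≤ κ * g x (m / ρ)) →
    g x₀ ((essSup u (volume.restrict (Metric.ball x₀ ρ)) + k) / ρ) ≤
      Γ * (κ ^ 2) ^ (ν + 1) * ⨍ x in Metric.ball x₀ (5 / 4 * ρ), g x₀ ((u x + k) / ρ) := by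
  set s : ℕ := ⌈q⌉₊ with hsdef
  have hqs : q ≤ s := Nat.le_ceil q
  have hs1 : (1 : ℝ) < s := hq.trans_le hqs
  have hs0 : s ≠ 0 := by
    intro h
    rw [h] at hs1
    norm_num at hs1
  obtain ⟨ε, hε, hDG⟩ := exists_deGiorgi hν hc₁ s hs0
  set N : ℕ := s * (ν + 1) with hN
  have hN0 : (0 : ℝ) < N := by
    rw [hN]
    push_cast
    positivity
  -- The gap σ t^i ρ enters De Giorgi's lemma with power N, a loss of t^(iN). This t makes the loss
  -- balance the gain 2^(i(p-1)) from (g₂).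
  set t : ℝ := 2 ^ (-(p - 1) / N) with ht
  have ht0 : 0 < t := Real.rpow_pos_of_pos two_pos _
  have ht1 : t < 1 := Real.rpow_lt_one_of_one_lt_of_neg one_lt_two
    (div_neg_of_neg_of_pos (by linarith) hN0)
  have htN : ∀ i : ℕ, (t ^ i) ^ N * (2 ^ i : ℝ) ^ (p - 1) = 1 := by
    intro i
    rw [← pow_mul, mul_comm i N, pow_mul, ht, ← Real.rpow_natCast (2 ^ (-(p - 1) / N)) N,
      ← Real.rpow_mul two_pos.le, div_mul_cancel₀ _ hN0.ne', ← Real.rpow_natCast 2 i,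
      ← Real.rpow_natCast _ i, ← Real.rpow_mul two_pos.le, ← Real.rpow_mul two_pos.le,
      ← Real.rpow_add two_pos]
    rw [show -(p - 1) * (i : ℝ) + i * (p - 1) = 0 by ring, Real.rpow_zero]
  set τ : ℝ := volume.real (Metric.ball (0 : EuclideanSpace ℝ (Fin (ν + 1))) 1) with hτ
  have hτ0 : 0 < τ := by
    rw [hτ, measureReal_def]
    exact ENNReal.toReal_pos (Metric.measure_ball_pos _ _ one_pos).ne' measure_ball_lt_top.ne
  set σ : ℝ := (1 - t) / 4 with hσ
  have hσ0 : 0 < σ := by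
    rw [hσ]
    linarith
  have h4 : (0 : ℝ) < 4 ^ (q - 1) := Real.rpow_pos_of_pos (by norm_num) _
  -- c₁ 4^(q-1) compares g at m with g above m/4, (5/4)^n τ is the volume of the averaging ball
  -- divided by ρ^n, and ε σ^N is the critical density in De Giorgi's lemma.
  refine ⟨c₁ * 4 ^ (q - 1) * ((5 / 4) ^ (ν + 1) * τ) / (ε * σ ^ N), by positivity, ?_⟩
  set Γ : ℝ := c₁ * 4 ^ (q - 1) * ((5 / 4) ^ (ν + 1) * τ) / (ε * σ ^ N) with hΓ
  intro Ω g b₀ u V B S x₀ ρ M k κ hρ hk hbk hκ hΩ hu0 huM hcomp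
  have hBΩ : Metric.ball x₀ (5 / 4 * ρ) ⊆ Ω :=
    (Metric.ball_subset_ball (by linarith)).trans (Metric.ball_subset_closedBall.trans hΩ)
  have hgr := S.growth x₀ (hBΩ (Metric.mem_ball_self (by positivity)))
  set R : ℕ → ℝ := fun i => ρ + (1 - t ^ i) / 4 * ρ with hR
  have hti : ∀ i : ℕ, 0 < t ^ i := fun i => pow_pos ht0 i
  have hti1 : ∀ i : ℕ, t ^ i ≤ 1 := fun i => pow_le_one₀ ht0.le ht1.le
  have hRρ : ∀ i, ρ ≤ R i := fun i => by
    have := mul_nonneg (sub_nonneg.2 (hti1 i)) hρ.le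
    simp only [hR]
    linarith
  have hR54 : ∀ i, R i < 5 / 4 * ρ := fun i => by
    have := mul_pos (hti i) hρ
    simp only [hR]
    linarith
  have hR0 : ∀ i, 0 < R i := fun i => hρ.trans_le (hRρ i)
  have hRd : ∀ i, R (i + 1) - R i = σ * t ^ i * ρ := fun i => by
    simp only [hR, hσ]
    ring
  have hball : ∀ i, Metric.ball x₀ (R i) ⊆ Metric.ball x₀ (5 / 4 * ρ) := fun i =>
    Metric.ball_subset_ball (hR54 i).le
  have hes := fun i => essSup_bounds (volume_restrict_ball_ne_zero x₀ (hR0 i))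
    (ae_restrict_of_ae_restrict_of_subset ((hball i).trans hBΩ) hu0)
    (ae_restrict_of_ae_restrict_of_subset ((hball i).trans hBΩ) huM)
  set m : ℕ → ℝ := fun i => essSup u (volume.restrict (Metric.ball x₀ (R i))) + k with hm
  have hmk : ∀ i, k ≤ m i := fun i => by
    have := (hes i).2.1
    simp only [hm]
    linarith
  have hmM : ∀ i, m i ≤ M + k := fun i => by
    have := (hes i).2.2.1
    simp only [hm]
    linarith
  have hm0 : ∀ i, 0 < m i := fun i => hk.trans_le (hmk i)
  have hum : ∀ i, ∀ᵐ x ∂(volume.restrict (Metric.ball x₀ (R i))), u x + k ≤ m i := fun i => by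
    filter_upwards [(hes i).1] with x hx
    simp only [hm]
    linarith
  set X : ℝ := ⨍ x in Metric.ball x₀ (5 / 4 * ρ), g x₀ ((u x + k) / ρ) with hX
  have hm_zero : essSup u (volume.restrict (Metric.ball x₀ ρ)) + k = m 0 := by
    simp only [hm, hR]
    norm_num
  rw [hm_zero]
  have hfin : IsFiniteMeasure (volume.restrict (Metric.ball x₀ (5 / 4 * ρ))) :=
    ⟨by rw [Measure.restrict_apply_univ]; exact measure_ball_lt_top⟩
  have iu : IntegrableOn u (Metric.ball x₀ (5 / 4 * ρ)) volume :=
    (S.integrableOn_closedBall hΩ).2.1.mono_set (Metric.ball_subset_ball (by linarith))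
  have hkρ : ∀ᵐ x ∂(volume.restrict (Metric.ball x₀ (5 / 4 * ρ))), k / ρ ≤ (u x + k) / ρ := by
    filter_upwards [ae_restrict_of_ae_restrict_of_subset hBΩ hu0] with x hx
    gcongr
    linarith
  have iG : IntegrableOn (fun x => g x₀ ((u x + k) / ρ)) (Metric.ball x₀ (5 / 4 * ρ)) volume := by
    refine hgr.integrable_comp (a := k / ρ) (b := (M + k) / ρ)
      ((iu.aestronglyMeasurable.aemeasurable.add_const k).div_const ρ) (by positivity) hkρ ?_
    filter_upwards [ae_restrict_of_ae_restrict_of_subset hBΩ huM] with x hx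
    gcongr
  have iG0 : 0 ≤ᵐ[volume.restrict (Metric.ball x₀ (5 / 4 * ρ))]
      fun x => g x₀ ((u x + k) / ρ) := by
    filter_upwards [hkρ] with x hx
    exact (hgr.pos _ (lt_of_lt_of_le (by positivity) hx)).le
  have hXint : ∫ x in Metric.ball x₀ (5 / 4 * ρ), g x₀ ((u x + k) / ρ) =
      (5 / 4 * ρ) ^ (ν + 1) * τ * X := by
    have hvol := volume_real_ball x₀ (show 0 < 5 / 4 * ρ by positivity)
    rw [hX, setAverage_eq, hvol, smul_eq_mul, ← mul_assoc, ← hτ,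
      mul_inv_cancel₀ (by positivity), one_mul]
  -- the alternative between two consecutive radii
  have halt : ∀ i, m i ≤ m (i + 1) / 2 ∨
      g x₀ (m (i + 1) / ρ) ≤ Γ * (κ ^ 2) ^ (ν + 1) * X * (2 ^ i : ℝ) ^ (p - 1) := by
    intro i
    have hmi := hm0 (i + 1)
    have hA₀ : 0 < g x₀ (m (i + 1) / ρ) := hgr.pos _ (by positivity)
    by_cases hsmall : volume.real (Metric.ball x₀ (R (i + 1)) ∩ {x | m (i + 1) / 4 < u x + k}) ≤
        ε * (((R (i + 1) - R i) / ρ) ^ s) ^ (ν + 1) * ρ ^ (ν + 1) / (κ ^ 2) ^ (ν + 1)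
    · left
      have hlt : R i < R (i + 1) := by
        have : 0 < σ * t ^ i * ρ := by
          have := hti i
          positivity
        linarith [hRd i]
      have hle : R (i + 1) - R i ≤ ρ := by linarith [hR54 (i + 1), hRρ i]
      have hres := hDG Ω g q b₀ p u V B S hqs x₀ (R i) (R (i + 1)) (2 * ρ) (hR0 i) hlt
        (by linarith [hR54 (i + 1)]) hΩ (m (i + 1)) ρ (g x₀ (m (i + 1) / ρ)) κ k hmi hρ hle hA₀ hκ
        (by rw [le_div_iff₀ hρ]; exact hbk.trans (hmk _)) (hum (i + 1))
        (fun x hx => (hcomp x (hball _ hx) _ (hmk _) (hmM _)).1)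
        (fun x hx => (hcomp x (hball _ hx) _ (hmk _) (hmM _)).2) hsmall
      have := (hes i).2.2.2 (m (i + 1) / 2 - k) (by
        filter_upwards [hres] with x hx
        linarith)
      simp only [hm] at this ⊢
      linarith
    · right
      rw [not_le] at hsmall
      set A := Metric.ball x₀ (R (i + 1)) ∩ {x | m (i + 1) / 4 < u x + k} with hA
      have hAsub : A ⊆ Metric.ball x₀ (5 / 4 * ρ) := inter_subset_left.trans (hball _)
      have hAfin : volume A ≠ ⊤ :=
        ((measure_mono inter_subset_left).trans_lt measure_ball_lt_top).ne
      have hlow : ∀ᵐ x ∂(volume.restrict (Metric.ball x₀ (5 / 4 * ρ))), x ∈ A →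
          g x₀ (m (i + 1) / ρ) ≤ c₁ * 4 ^ (q - 1) * g x₀ ((u x + k) / ρ) := by
        filter_upwards [ae_restrict_of_ae_restrict_of_subset hBΩ hu0] with x hx hxA
        have hx2 : m (i + 1) / 4 < u x + k := hxA.2
        have hw0 : 0 < (u x + k) / ρ := by positivity
        have hwb : b₀ ≤ (u x + k) / ρ := by
          rw [le_div_iff₀ hρ]
          linarith
        have hG := hgr.pos _ hw0
        rcases le_total (u x + k) (m (i + 1)) with hle | hle
        · refine (hgr.upper _ _ hw0 hwb (by gcongr)).trans ?_
          have hratio : m (i + 1) / ρ / ((u x + k) / ρ) ≤ 4 := by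
            rw [div_div_div_cancel_right₀ hρ.ne', div_le_iff₀ (by positivity)]
            linarith
          have : (m (i + 1) / ρ / ((u x + k) / ρ)) ^ (q - 1) ≤ 4 ^ (q - 1) :=
            Real.rpow_le_rpow (by positivity) hratio (by linarith)
          gcongr
        · have h1 : g x₀ (m (i + 1) / ρ) ≤ g x₀ ((u x + k) / ρ) :=
            hgr.mono _ _ (by positivity) (by gcongr)
          have h2 : 1 ≤ c₁ * 4 ^ (q - 1) :=
            one_le_mul_of_one_le_of_one_le hgr.one_le_c₁
              (Real.one_le_rpow (by norm_num) (by linarith))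
          nlinarith
      have hAint : g x₀ (m (i + 1) / ρ) * volume.real A ≤
          c₁ * 4 ^ (q - 1) * ((5 / 4 * ρ) ^ (ν + 1) * τ * X) := by
        have hAm : NullMeasurableSet {x | m (i + 1) / 4 < u x + k}
            (volume.restrict (Metric.ball x₀ (5 / 4 * ρ))) :=
          nullMeasurableSet_lt aemeasurable_const (iu.aestronglyMeasurable.aemeasurable.add_const k)
        have hAm' : NullMeasurableSet A (volume.restrict (Metric.ball x₀ (5 / 4 * ρ))) :=
          measurableSet_ball.nullMeasurableSet.inter hAm
        have e1 : volume.real A = (volume.restrict (Metric.ball x₀ (5 / 4 * ρ))).real A := by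
          rw [measureReal_def, measureReal_def, Measure.restrict_apply₀ hAm',
            inter_eq_self_of_subset_left hAsub]
        rw [← hXint, e1, ← integral_const_mul, mul_comm, ← smul_eq_mul, ← setIntegral_const,
          ← integral_indicator₀ hAm']
        refine integral_mono_ae ((integrable_const _).indicator₀ hAm') (iG.const_mul _) ?_
        filter_upwards [hlow, iG0] with x hx hx0
        by_cases hxA : x ∈ A
        · rw [indicator_of_mem hxA]
          exact hx hxA
        · rw [indicator_of_notMem hxA]
          have : 0 ≤ g x₀ ((u x + k) / ρ) := hx0
          positivity
      have hX0 : g x₀ (m (i + 1) / ρ) *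
          (ε * (((R (i + 1) - R i) / ρ) ^ s) ^ (ν + 1) * ρ ^ (ν + 1) / (κ ^ 2) ^ (ν + 1)) ≤
          c₁ * 4 ^ (q - 1) * ((5 / 4 * ρ) ^ (ν + 1) * τ * X) :=
        (mul_le_mul_of_nonneg_left hsmall.le hA₀.le).trans hAint
      have e2 : (((R (i + 1) - R i) / ρ) ^ s) ^ (ν + 1) = σ ^ N * (t ^ i) ^ N := by
        rw [hRd, mul_div_cancel_right₀ _ hρ.ne', ← pow_mul, mul_pow]
      rw [e2, mul_pow] at hX0
      have hti0 := hti i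
      have h2i : (0 : ℝ) < (2 ^ i : ℝ) ^ (p - 1) := Real.rpow_pos_of_pos (by positivity) _
      have hκ0 : 0 < κ := by linarith
      have e3 : g x₀ (m (i + 1) / ρ) *
          (ε * (σ ^ N * (t ^ i) ^ N) * ρ ^ (ν + 1) / (κ ^ 2) ^ (ν + 1)) =
          (ε * σ ^ N * ρ ^ (ν + 1)) * (t ^ i) ^ N * (g x₀ (m (i + 1) / ρ) / (κ ^ 2) ^ (ν + 1)) := by
        ring
      have e4 : c₁ * 4 ^ (q - 1) * ((5 / 4) ^ (ν + 1) * ρ ^ (ν + 1) * τ * X) =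
          (ε * σ ^ N * ρ ^ (ν + 1)) * (t ^ i) ^ N * (Γ * X * (2 ^ i : ℝ) ^ (p - 1)) := by
        calc _ = (ε * σ ^ N * ρ ^ (ν + 1)) * (Γ * X) := by
              rw [hΓ]
              field_simp
          _ = (ε * σ ^ N * ρ ^ (ν + 1)) * (Γ * X) * ((t ^ i) ^ N * (2 ^ i : ℝ) ^ (p - 1)) := by
              rw [htN, mul_one]
          _ = _ := by ring
      rw [e3, e4] at hX0
      have h5 := le_of_mul_le_mul_left hX0 (by positivity)
      rw [div_le_iff₀ (by positivity)] at h5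
      linarith
  by_contra hcon
  rw [not_le] at hcon
  -- In the second alternative, m_{i+1} ≥ 2^i m_0 and (g₂) would cancel the factor 2^(i(p-1)) and
  -- give the negated estimate. Hence the supremum doubles at every step.
  have hy : ∀ i, 2 ^ i * m 0 ≤ m i := by
    intro i
    induction i with
    | zero => simp
    | succ i ih =>
      rcases halt i with h | h
      · rw [pow_succ]
        linarith
      · exfalso
        have h1 : m i ≤ m (i + 1) := by
          have hsub : Metric.ball x₀ (R i) ⊆ Metric.ball x₀ (R (i + 1)) := by
            refine Metric.ball_subset_ball ?_
            have : 0 ≤ σ * t ^ i * ρ := by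
              have := hti i
              positivity
            linarith [hRd i]
          have := (hes i).2.2.2 (m (i + 1) - k) (by
            filter_upwards [ae_restrict_of_ae_restrict_of_subset hsub (hum (i + 1))] with x hx
            linarith)
          simp only [hm] at this ⊢
          linarith
        have h2 : 2 ^ i * m 0 ≤ m (i + 1) := ih.trans h1
        have h3 : (2 ^ i : ℝ) ^ (p - 1) * g x₀ (m 0 / ρ) ≤ g x₀ (m (i + 1) / ρ) := by
          have hm00 := hm0 0
          have hle : m 0 / ρ ≤ m (i + 1) / ρ := by
            have : (1 : ℝ) ≤ 2 ^ i := one_le_pow₀ (by norm_num)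
            gcongr
            nlinarith
          refine le_trans ?_ (hgr.lower (m 0 / ρ) _ (by positivity) hle)
          have : 0 < g x₀ (m 0 / ρ) := hgr.pos _ (by positivity)
          gcongr
          rw [div_div_div_cancel_right₀ hρ.ne', le_div_iff₀ hm00]
          exact h2
        have h2i : (0 : ℝ) < (2 ^ i : ℝ) ^ (p - 1) := Real.rpow_pos_of_pos (by positivity) _
        have h4 := h3.trans h
        rw [mul_comm] at h4
        exact absurd (le_of_mul_le_mul_right h4 h2i) (not_le.2 hcon)
  have htop : Tendsto (fun i : ℕ => (2 : ℝ) ^ i * m 0) atTop atTop :=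
    (tendsto_pow_atTop_atTop_of_one_lt one_lt_two).atTop_mul_const (hm0 0)
  obtain ⟨i, hi⟩ := (htop.eventually_gt_atTop (M + k)).exists
  linarith [hy i, hmM i]

/-! ### Use of (g₃) and conclusion. -/

/-- Every point of the ball of radius `5ρ/4` lies with the centre in a ball `B_r(y)` whose eightfold
enlargement stays in a slightly larger concentric ball. -/
theorem exists_common_ball {n : ℕ} {x₀ x : EuclideanSpace ℝ (Fin n)} {ρ r : ℝ} (hρ : 0 < ρ)
    (hr : 27 / 28 * ρ ≤ r) (hrρ : r ≤ ρ) (hx : x ∈ Metric.ball x₀ (5 / 4 * ρ)) :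
    ∃ y, Metric.ball y (8 * r) ⊆ Metric.ball x₀ (7 * r + 5 / 4 * ρ) ∧
      x ∈ Metric.ball y r ∧ x₀ ∈ Metric.ball y r := by
  -- The centre y lies on the segment from x₀ to x, at distance at most d < r from x₀ and less than
  -- r from x. The enlarged ball reaches 8r + d = 7r + 5ρ/4.
  set d : ℝ := 5 / 4 * ρ - r with hd
  have hd0 : 0 ≤ d := by linarith
  have hr0 : 0 < r := by linarith
  set τ : ℝ := d / (5 / 4 * ρ) with hτ
  have hρ' : 0 < 5 / 4 * ρ := by linarith
  have hτ0 : 0 ≤ τ := by positivity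
  have hτd : τ * (5 / 4 * ρ) = d := div_mul_cancel₀ _ hρ'.ne'
  have hτ1 : 0 < 1 - τ := by
    rw [sub_pos, hτ, div_lt_one hρ']
    linarith
  rw [mem_ball_iff_norm] at hx
  have h1 : ‖(x₀ + τ • (x - x₀)) - x₀‖ ≤ d := by
    rw [add_sub_cancel_left, norm_smul, Real.norm_of_nonneg hτ0, ← hτd]
    gcongr
  refine ⟨x₀ + τ • (x - x₀), Metric.ball_subset_ball' ?_, ?_, ?_⟩
  · rw [dist_eq_norm]
    linarith
  · rw [mem_ball_iff_norm, show x - (x₀ + τ • (x - x₀)) = (1 - τ) • (x - x₀) by module,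
      norm_smul, Real.norm_of_nonneg hτ1.le]
    calc (1 - τ) * ‖x - x₀‖ < (1 - τ) * (5 / 4 * ρ) := by gcongr
      _ = r := by rw [sub_mul, hτd]; linarith
  · rw [mem_ball_iff_norm, norm_sub_rev]
    linarith

/-- Condition `(g₃)`, extended slightly beyond `v = K` by means of `(g₁)`. -/
theorem Growth.compare {c₁ q b₀ p : ℝ} {G₁ G₂ : ℝ → ℝ} (h₁ : Growth c₁ q b₀ p G₁)
    (h₂ : Growth c₁ q b₀ p G₂) {K C r v : ℝ} (hr : 0 < r) (hrK : r ≤ K) (hbK : b₀ ≤ K / r)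
    (hC : 0 < C) (h : ∀ v, r ≤ v → v ≤ K → G₁ (v / r) ≤ C * G₂ (v / r)) (hrv : r ≤ v)
    (hv : v ≤ 2 * K) : G₁ (v / r) ≤ C * (c₁ * 2 ^ (q - 1)) * G₂ (v / r) := by
  have hq := h₁.one_lt_q
  have hc := h₁.c₁_pos
  have hK : 0 < K := by linarith
  have hv0 : 0 < v := by linarith
  have h2 : 1 ≤ c₁ * 2 ^ (q - 1) :=
    one_le_mul_of_one_le_of_one_le h₁.one_le_c₁ (Real.one_le_rpow (by norm_num) (by linarith))
  have hG2 : 0 < G₂ (v / r) := h₂.pos _ (by positivity)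
  rcases le_total v K with hvK | hvK
  · refine (h v hrv hvK).trans ?_
    have : C * 1 ≤ C * (c₁ * 2 ^ (q - 1)) := by gcongr
    nlinarith
  -- Beyond K, (g₁) brings the argument back to K/r, the comparison is made there, and monotonicity
  -- of G₂ returns to v/r.
  · have e1 := h₁.upper (K / r) (v / r) (by positivity) hbK (by gcongr)
    rw [div_div_div_cancel_right₀ hr.ne'] at e1
    have e2 : (v / K) ^ (q - 1) ≤ 2 ^ (q - 1) :=
      Real.rpow_le_rpow (by positivity) ((div_le_iff₀ hK).2 hv) (by linarith)
    have e3 : G₁ (K / r) ≤ C * G₂ (v / r) :=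
      (h K hrK le_rfl).trans (mul_le_mul_of_nonneg_left
        (h₂.mono _ _ (by positivity) (by gcongr)) hC.le)
    calc G₁ (v / r) ≤ c₁ * (v / K) ^ (q - 1) * G₁ (K / r) := e1
      _ ≤ c₁ * 2 ^ (q - 1) * (C * G₂ (v / r)) := by
        have := h₁.pos (K / r) (by positivity)
        gcongr
      _ = _ := by ring

/-- The sub-estimate for solutions that are small compared with the radius. -/
theorem Growth.subestimate_of_small {α : Type*} [MeasurableSpace α] {μ : Measure α}
    [IsFiniteMeasure μ] (hμ : μ ≠ 0) {c₁ q b₀ p : ℝ} {G : ℝ → ℝ} (h : Growth c₁ q b₀ p G)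
    {u : α → ℝ} (hu : AEMeasurable u μ) {M ρ k m : ℝ} (hρ : 0 < ρ) (hk : 0 < k)
    (hbk : b₀ * ρ ≤ k) (hMk : M ≤ k) (h0 : ∀ᵐ x ∂μ, 0 ≤ u x) (hM : ∀ᵐ x ∂μ, u x ≤ M)
    (hm : m ≤ M) (hm0 : 0 ≤ m) :
    G ((m + k) / ρ) ≤ c₁ * 2 ^ (q - 1) * ⨍ x, G ((u x + k) / ρ) ∂μ := by
  have hc := h.c₁_pos
  have hq := h.one_lt_q
  have hne : NeZero μ := ⟨hμ⟩
  have hi : Integrable (fun x => G ((u x + k) / ρ)) μ := by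
    refine h.integrable_comp (a := k / ρ) (b := (M + k) / ρ) ((hu.add_const k).div_const ρ)
      (by positivity) ?_ ?_
    · filter_upwards [h0] with x hx
      gcongr
      linarith
    · filter_upwards [hM] with x hx
      gcongr
  -- All arguments lie between k/ρ and 2k/ρ, where (g₁) makes G constant up to the factor c₁
  -- 2^(q-1).
  have hle : ∀ᵐ x ∂μ, G ((m + k) / ρ) ≤ c₁ * 2 ^ (q - 1) * G ((u x + k) / ρ) := by
    filter_upwards [h0] with x hx
    have hmk : 0 < (m + k) / ρ := by positivity
    have hkρ : b₀ ≤ k / ρ := (le_div_iff₀ hρ).2 hbk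
    have e1 := h.upper (k / ρ) ((m + k) / ρ) (by positivity) hkρ (by gcongr; linarith)
    rw [div_div_div_cancel_right₀ hρ.ne'] at e1
    have e2 : ((m + k) / k) ^ (q - 1) ≤ 2 ^ (q - 1) :=
      Real.rpow_le_rpow (by positivity) ((div_le_iff₀ hk).2 (by linarith)) (by linarith)
    have e3 : G (k / ρ) ≤ G ((u x + k) / ρ) := h.mono _ _ (by positivity) (by gcongr; linarith)
    have e4 := h.pos (k / ρ) (by positivity)
    exact e1.trans (by gcongr)
  calc G ((m + k) / ρ) = ⨍ _, G ((m + k) / ρ) ∂μ := (average_const μ _).symm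
    _ ≤ ⨍ x, c₁ * 2 ^ (q - 1) * G ((u x + k) / ρ) ∂μ := by
      rw [average_eq, average_eq, smul_eq_mul, smul_eq_mul]
      exact mul_le_mul_of_nonneg_left (integral_mono_ae (integrable_const _) (hi.const_mul _) hle)
        (by positivity)
    _ = _ := by
      rw [average_eq, average_eq, integral_const_mul, smul_eq_mul, smul_eq_mul]
      ring

/-- Membership in L^∞ provides the upper bound that makes the real-valued `essSup` a genuine one. -/
theorem isBoundedWeakSolution_ae_le {n : ℕ} {Ω : Set (EuclideanSpace ℝ (Fin n))}
    (hΩ : IsOpen Ω) (hne : Ω.Nonempty) {u : EuclideanSpace ℝ (Fin n) → ℝ}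
    (hu : MemLp u ⊤ (volume.restrict Ω)) :
    ∀ᵐ x ∂(volume.restrict Ω), |u x| ≤ essSup (fun x => |u x|) (volume.restrict Ω) := by
  have hμ : volume.restrict Ω ≠ 0 := by
    rw [Ne, Measure.restrict_eq_zero]
    exact (hΩ.measure_pos volume hne).ne'
  refine (essSup_bounds hμ (M := (eLpNorm u ⊤ (volume.restrict Ω)).toReal)
    (Eventually.of_forall fun x => abs_nonneg _) ?_).1
  filter_upwards [ae_le_eLpNormEssSup (f := u) (μ := volume.restrict Ω)] with x hx
  rw [← Real.norm_eq_abs, ← toReal_enorm, eLpNorm_exponent_top]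
  refine ENNReal.toReal_mono ?_ hx
  rw [← eLpNorm_exponent_top]
  exact hu.eLpNorm_lt_top.ne

/-- The sub-estimate with `(g₃)` used at a radius `r` between `27ρ/28` and `ρ`. -/
theorem exists_subestimate_radius {n : ℕ} (hn : 2 ≤ n) {p q c₁ : ℝ} (hc₁ : 0 < c₁) (hq : 1 < q)
    (hp : 1 < p) (C₂ : ℝ) :
    ∃ γ : ℝ, 0 < γ ∧
      ∀ (Ω : Set (EuclideanSpace ℝ (Fin n)))
        (g : EuclideanSpace ℝ (Fin n) → ℝ → ℝ) (b₀ : ℝ) (c₂ : ℝ → ℝ) (rStar : ℝ) (lam : ℝ → ℝ)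
        (u : EuclideanSpace ℝ (Fin n) → ℝ)
        (V : EuclideanSpace ℝ (Fin n) → EuclideanSpace ℝ (Fin n)) (M : ℝ),
        SolutionData Ω g c₁ q b₀ p u V M → CondG3 Ω g c₂ rStar lam → c₂ M = C₂ →
        (∀ᵐ x ∂(volume.restrict Ω), 0 ≤ u x) →
      ∀ (x₀ : EuclideanSpace ℝ (Fin n)) (ρ r : ℝ),
        0 < ρ → ρ < rStar → 27 / 28 * ρ ≤ r → r ≤ ρ →
        Metric.ball x₀ (7 * r + 5 / 4 * ρ) ⊆ Ω →
        g x₀ ((essSup u (volume.restrict (Metric.ball x₀ ρ)) + 2 * (1 + b₀) * ρ) / ρ) ≤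
          γ * Real.exp (2 * n * lam r) *
            ⨍ x in Metric.ball x₀ (5 / 4 * ρ), g x₀ ((u x + 2 * (1 + b₀) * ρ) / ρ) := by
  obtain ⟨ν, rfl⟩ : ∃ ν, n = ν + 1 := ⟨n - 1, by omega⟩
  obtain ⟨Γ, hΓ, hsub⟩ := exists_subestimate (ν := ν) (by omega) hc₁ hq hp
  have h2q : (0 : ℝ) < 2 ^ (q - 1) := Real.rpow_pos_of_pos two_pos _
  -- The maximum with 1 makes κ = D e^{λ(r)} at least 1; c₁ 2^(q-1) pays for arguments beyond M.
  set D : ℝ := max C₂ 1 * (c₁ * 2 ^ (q - 1)) with hD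
  have hm1 : (0 : ℝ) < max C₂ 1 := lt_of_lt_of_le one_pos (le_max_right _ _)
  have hD0 : 0 < D := by positivity
  refine ⟨Γ * (D ^ 2) ^ (ν + 1) + c₁ * 2 ^ (q - 1), by positivity, ?_⟩
  intro Ω g b₀ c₂ rStar lam u V M S hg3 hcM hu0 x₀ ρ r hρ hρr hr hrρ hballΩ
  have hr0 : 0 < r := by linarith
  have hrS : r ∈ Ioo 0 rStar := ⟨hr0, by linarith⟩
  have hΩ2 : Metric.closedBall x₀ (2 * ρ) ⊆ Ω :=
    (Metric.closedBall_subset_ball (by linarith)).trans hballΩ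
  have hBΩ : Metric.ball x₀ (5 / 4 * ρ) ⊆ Ω :=
    (Metric.ball_subset_ball (by linarith)).trans hballΩ
  have hx₀ : x₀ ∈ Metric.ball x₀ (5 / 4 * ρ) := Metric.mem_ball_self (by positivity)
  have hgr := S.growth x₀ (hBΩ hx₀)
  have hb := hgr.b₀_nonneg
  have hlam : 0 ≤ lam r := hg3.2.2.2.1 r hrS
  have huM : ∀ᵐ x ∂(volume.restrict Ω), u x ≤ M := by
    filter_upwards [S.bound] with x hx using (le_abs_self _).trans hx
  set k : ℝ := 2 * (1 + b₀) * ρ with hk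
  have hbρ : 0 ≤ b₀ * ρ := by positivity
  have hk2 : k = 2 * ρ + 2 * (b₀ * ρ) := by rw [hk]; ring
  have hk0 : 0 < k := by linarith
  have hbk : b₀ * ρ ≤ k := by linarith
  set X : ℝ := ⨍ x in Metric.ball x₀ (5 / 4 * ρ), g x₀ ((u x + k) / ρ) with hX
  have hX0 : 0 ≤ X := by
    rw [hX, setAverage_eq, smul_eq_mul]
    refine mul_nonneg (by positivity) (integral_nonneg_of_ae ?_)
    filter_upwards [ae_restrict_of_ae_restrict_of_subset hBΩ hu0] with x hx
    exact (hgr.pos _ (by positivity)).le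
  have hexp : 1 ≤ Real.exp (2 * ((ν + 1 : ℕ) : ℝ) * lam r) :=
    Real.one_le_exp (by positivity)
  -- If M ≤ k, no comparison between different points is needed. If k ≤ M, then M + k ≤ 2M, within
  -- reach of (g₃) with K = M extended by (g₁).
  rcases le_total M k with hMk | hkM
  · have hfin : IsFiniteMeasure (volume.restrict (Metric.ball x₀ (5 / 4 * ρ))) :=
      ⟨by rw [Measure.restrict_apply_univ]; exact measure_ball_lt_top⟩
    have hρΩ : Metric.ball x₀ ρ ⊆ Ω := (Metric.ball_subset_ball (by linarith)).trans hBΩ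
    have hes := essSup_bounds (volume_restrict_ball_ne_zero x₀ hρ)
      (ae_restrict_of_ae_restrict_of_subset hρΩ hu0)
      (ae_restrict_of_ae_restrict_of_subset hρΩ huM)
    have iu : IntegrableOn u (Metric.ball x₀ (5 / 4 * ρ)) volume :=
      (S.integrableOn_closedBall hΩ2).2.1.mono_set (Metric.ball_subset_ball (by linarith))
    refine (hgr.subestimate_of_small
      (volume_restrict_ball_ne_zero x₀ (show 0 < 5 / 4 * ρ by positivity))
      iu.aestronglyMeasurable.aemeasurable hρ hk0 hbk hMk
      (ae_restrict_of_ae_restrict_of_subset hBΩ hu0)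
      (ae_restrict_of_ae_restrict_of_subset hBΩ huM) hes.2.2.1 hes.2.1).trans ?_
    rw [← hX]
    refine mul_le_mul_of_nonneg_right ?_ hX0
    have h1 : 0 ≤ Γ * (D ^ 2) ^ (ν + 1) := by positivity
    have h2 : 0 ≤ c₁ * 2 ^ (q - 1) := by positivity
    nlinarith
  · have hM0 : 0 < M := by linarith
    have hc1 := hgr.one_le_c₁
    have hD1 : 1 ≤ D := one_le_mul_of_one_le_of_one_le (le_max_right _ _)
      (one_le_mul_of_one_le_of_one_le hc1 (Real.one_le_rpow (by norm_num) (by linarith)))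
    have hcomp : ∀ x ∈ Metric.ball x₀ (5 / 4 * ρ), ∀ m, k ≤ m → m ≤ M + k →
        g x (m / ρ) ≤ D * Real.exp (lam r) * g x₀ (m / ρ) ∧
        g x₀ (m / ρ) ≤ D * Real.exp (lam r) * g x (m / ρ) := by
      intro x hx m hkm hmM
      obtain ⟨y, hy, hxy, hx₀y⟩ := exists_common_ball hρ hr hrρ hx
      have h3 := (hg3.2.2.2.2 M hM0).2 y r hrS (hy.trans hballΩ)
      -- At radius r, (g₃) speaks of v/r, so m/ρ corresponds to v = mr/ρ. This is at least r because
      -- m ≥ k ≥ ρ, and at most 2M because r ≤ ρ.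
      have hv : m / ρ = m * r / ρ / r := by field_simp
      have hm0 : 0 < m := by linarith
      have hrv : r ≤ m * r / ρ := by
        rw [le_div_iff₀ hρ]
        nlinarith
      have hv2 : m * r / ρ ≤ 2 * M := by
        rw [div_le_iff₀ hρ]
        nlinarith
      have hbM : b₀ ≤ M / r := by
        rw [le_div_iff₀ hr0]
        nlinarith
      have key : ∀ x₁ ∈ Metric.ball x₀ (5 / 4 * ρ), ∀ x₂ ∈ Metric.ball x₀ (5 / 4 * ρ),
          x₁ ∈ Metric.ball y r → x₂ ∈ Metric.ball y r →
          g x₁ (m / ρ) ≤ D * Real.exp (lam r) * g x₂ (m / ρ) := by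
        intro x₁ hx₁ x₂ hx₂ hx₁y hx₂y
        have hg2 := S.growth x₂ (hBΩ hx₂)
        have := (S.growth x₁ (hBΩ hx₁)).compare hg2 (K := M)
          (C := max C₂ 1 * Real.exp (lam r)) (v := m * r / ρ) hr0 (by linarith) hbM
          (by positivity) (fun v hrv hvM => by
            refine (h3 x₁ hx₁y x₂ hx₂y v hrv hvM).trans ?_
            have := hg2.pos (v / r) (by have : 0 < v := by linarith
                                        positivity)
            rw [hcM]
            gcongr
            exact le_max_left _ _) hrv hv2
        rw [hv]
        refine this.trans (le_of_eq ?_)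
        rw [hD]
        ring
      exact ⟨key x hx x₀ hx₀ hxy hx₀y, key x₀ hx₀ x hx hx₀y hxy⟩
    have hκ : 1 ≤ D * Real.exp (lam r) :=
      one_le_mul_of_one_le_of_one_le hD1 (Real.one_le_exp hlam)
    refine (hsub Ω g b₀ u V M S x₀ ρ M k _ hρ hk0 hbk hκ hΩ2 hu0 huM hcomp).trans ?_
    rw [← hX]
    have he : ((D * Real.exp (lam r)) ^ 2) ^ (ν + 1) =
        (D ^ 2) ^ (ν + 1) * Real.exp (2 * ((ν + 1 : ℕ) : ℝ) * lam r) := by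
      rw [mul_pow, mul_pow, ← pow_mul (Real.exp _), ← Real.exp_nat_mul]
      push_cast
      ring_nf
    rw [he, ← mul_assoc]
    gcongr
    have : 0 < c₁ * 2 ^ (q - 1) := by positivity
    linarith

end OrliczHarnack

theorem theorem1p2 (n : ℕ) (hn : 2 ≤ n) (p q c₁ M C₂ : ℝ) :
    ∃ γ : ℝ, 0 < γ ∧
      ∀ (Ω : Set (EuclideanSpace ℝ (Fin n))), IsOpen Ω → IsConnected Ω → Bornology.IsBounded Ω →
      ∀ (g : EuclideanSpace ℝ (Fin n) → ℝ → ℝ) (b₀ : ℝ) (c₂ : ℝ → ℝ) (rStar : ℝ) (lam : ℝ → ℝ),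
        OrliczHarnack.CondG Ω g → OrliczHarnack.CondG1 Ω g c₁ q b₀ →
        OrliczHarnack.CondG2 Ω g p → OrliczHarnack.CondG3 Ω g c₂ rStar lam → c₂ M = C₂ →
      ∀ u : EuclideanSpace ℝ (Fin n) → ℝ,
        OrliczHarnack.IsBoundedWeakSolution Ω g u →
        (∀ᵐ x ∂(volume.restrict Ω), 0 ≤ u x) →
        essSup (fun x => |u x|) (volume.restrict Ω) = M →
      ∀ (x₀ : EuclideanSpace ℝ (Fin n)) (ρ : ℝ),
        0 < ρ → ρ < rStar → Metric.ball x₀ (8 * ρ) ⊆ Ω →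
        (g x₀ ((essSup u (volume.restrict (Metric.ball x₀ ρ)) + 2 * (1 + b₀) * ρ) / ρ) ≤
          γ * Real.exp (2 * n * lam (27 / 28 * ρ)) *
            ⨍ x in Metric.ball x₀ (5 / 4 * ρ), g x₀ ((u x + 2 * (1 + b₀) * ρ) / ρ)) ∧
        (Metric.ball x₀ (33 / 4 * ρ) ⊆ Ω →
          g x₀ ((essSup u (volume.restrict (Metric.ball x₀ ρ)) + 2 * (1 + b₀) * ρ) / ρ) ≤
            γ * Real.exp (2 * n * lam ρ) *
              ⨍ x in Metric.ball x₀ (5 / 4 * ρ), g x₀ ((u x + 2 * (1 + b₀) * ρ) / ρ)) := by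
  -- γ is fixed before the growth conditions are assumed; for inadmissible parameters they are
  -- contradictory and any γ serves.
  by_cases hpar : 0 < c₁ ∧ 1 < q ∧ 1 < p
  · obtain ⟨hc₁, hq, hp⟩ := hpar
    obtain ⟨γ, hγ, h⟩ := OrliczHarnack.exists_subestimate_radius hn hc₁ hq hp C₂
    refine ⟨γ, hγ, ?_⟩
    intro Ω hΩ hconn _ g b₀ c₂ rStar lam hg hg1 hg2 hg3 hcM u hu hu0 huM x₀ ρ hρ hρr hball
    obtain ⟨hLp, V, hV, hweak⟩ := hu
    have hbd := OrliczHarnack.isBoundedWeakSolution_ae_le hΩ hconn.nonempty hLp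
    rw [huM] at hbd
    have S : OrliczHarnack.SolutionData Ω g c₁ q b₀ p u V M :=
      ⟨hΩ, hg, fun x hx => OrliczHarnack.growth_of_cond hg hg1 hg2 hx, hV, hbd, hweak⟩
    -- The radius 7r + 5ρ/4 equals 8ρ for r = 27ρ/28 and 33ρ/4 for r = ρ.
    refine ⟨h Ω g b₀ c₂ rStar lam u V M S hg3 hcM hu0 x₀ ρ (27 / 28 * ρ) hρ hρr le_rfl
      (by linarith) ?_, fun hball2 => h Ω g b₀ c₂ rStar lam u V M S hg3 hcM hu0 x₀ ρ ρ hρ hρr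
      (by linarith) le_rfl ?_⟩
    · exact (Metric.ball_subset_ball (by linarith)).trans hball
    · exact (Metric.ball_subset_ball (by linarith)).trans hball2
  · refine ⟨1, one_pos, ?_⟩
    intro Ω _ _ _ g b₀ c₂ rStar lam _ hg1 hg2
    exact absurd ⟨hg1.1, hg1.2.1, hg2.1⟩ hpar
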